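/- Let $\mathbb{T}\subset\mathbb{R}$ be a time scale (a nonempty closed set) that is unbounded above and has bounded graininess $\mu(t)=\sigma(t)-t$, where $\sigma(t)=\inf\{s\in\mathbb{T}: s>t\}$. Let $A(t)\in\mathbb{R}^{n\times n}$, $B(t)\in\mathbb{R}^{n\times m}$, $C(t)\in\mathbb{R}^{p\times n}$ be rd-continuous on $\mathbb{T}$, with $A$ regressive: $I+\mu(t)A(t)$ is invertible for all $t\in\mathbb{T}$. Vectors carry the Euclidean norm and matrices the induced operator norm. Let $\Phi_A(t,s)$ be the transition matrix, i.e. the solution of $X^\Delta=AX$, $X(s)=I$, and put $G(t,\sigma(s))=C(t)\Phi_A(t,\sigma(s))B(s)$. The system $$x^\Delta(t)=A(t)x(t)+B(t)u(t),\qquad y(t)=C(t)x(t)$$ is called uniformly bounded-input, bounded-output (BIBO) stable if there is a finite constant $\eta\ge 0$ such that for every $t_0\in\mathbb{T}$ and every rd-continuous input $u$ on $\mathbb{T}\cap[t_0,\infty)$, the zero-state response $y$ (the output for the solution with $x(t_0)=0$) satisfies $$\sup_{t\ge t_0}\|y(t)\|\le\eta\,\sup_{t\ge t_0}\|u(t)\|,$$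 where the suprema are over $t\in\mathbb{T}$ and taken in $[0,\infty]$ (with $0\cdot\infty=0$). Then the system is uniformly BIBO stable if and only if there is a finite constant $\rho\ge 0$ such that $$\int_\tau^t\|G(t,\sigma(s))\|\,\Delta s\le\rho\qquad\text{for all } \tau,t\in\mathbb{T} \text{ with } t\ge\tau.$$ The same equivalence holds if, in the definition of uniform BIBO stability, all $\Delta$-measurable inputs $u$ are admitted and solutions are understood in the sense of Carathéodory, i.e. $x(t)=\int_{t_0}^t\big(A(s)x(s)+B(s)u(s)\big)\,\Delta s$ for all $t\in\mathbb{T}$, $t\ge t_0$, with $\Delta$-integrable integrand. -/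

import Mathlib

open Set Filter Topology MeasureTheory
open scoped ENNReal NNReal
-- Matrices carry the operator norm induced by the Euclidean norms.
open scoped Matrix.Norms.L2Operator

noncomputable section

namespace TimeScale

/-- The forward jump operator `σ(t) = inf {s ∈ T : s > t}` of a time scale `T`. -/
def sigma (T : Set ℝ) (t : ℝ) : ℝ := sInf (T ∩ Ioi t)

/-- The graininess `μ(t) = σ(t) - t`. -/
def graininess (T : Set ℝ) (t : ℝ) : ℝ := sigma T t - t

/-- Right-dense points: `σ(t) = t`. -/
def RightDense (T : Set ℝ) (t : ℝ) : Prop := sigma T t = t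

/-- Left-dense points: limits of points of `T` that are strictly smaller. -/
def LeftDense (T : Set ℝ) (t : ℝ) : Prop := t ∈ closure (T ∩ Iio t)

/-- `f` is rd-continuous on `T`: continuous at right-dense points, with (finite) left-sided limits
at left-dense points. Only the values of `f` on `T` matter. -/
def RdContinuous {E : Type*} [TopologicalSpace E] (T : Set ℝ) (f : ℝ → E) : Prop :=
  ∀ t ∈ T, (RightDense T t → ContinuousWithinAt f T t) ∧
    (LeftDense T t → ∃ l : E, Tendsto f (𝓝[T ∩ Iio t] t) (𝓝 l))

/-- `f^Δ(t) = f'`: for every `ε > 0`,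
`‖f(σ(t)) - f(s) - (σ(t) - s) f'‖ ≤ ε |σ(t) - s|` for all `s ∈ T` close to `t`. -/
def HasDeltaDerivAt {E : Type*} [NormedAddCommGroup E] [NormedSpace ℝ E]
    (T : Set ℝ) (f : ℝ → E) (f' : E) (t : ℝ) : Prop :=
  ∀ ε > 0, ∀ᶠ s in 𝓝[T] t,
    ‖f (sigma T t) - f s - (sigma T t - s) • f'‖ ≤ ε * |sigma T t - s|

/-- The Lebesgue Δ-measure of `T`: Lebesgue measure on `T` plus a mass `μ(t)` at each
right-scattered point `t` of `T`. The Δ-integral from `a` to `b` (`a ≤ b` in `T`) is the integral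
over `[a, b)` for this measure. -/
def deltaMeasure (T : Set ℝ) : Measure ℝ :=
  volume.restrict T +
    Measure.sum (fun t : {t : ℝ // t ∈ T ∧ t < sigma T t} =>
      ENNReal.ofReal (graininess T t) • Measure.dirac (t : ℝ))

theorem sigma_le {T : Set ℝ} {t s : ℝ} (hs : s ∈ T) (hts : t < s) : sigma T t ≤ s :=
  csInf_le ⟨t, fun _ h => h.2.le⟩ ⟨hs, hts⟩

/-- The Δ-measure is the one that gives `[a, b)` the mass `b - a` for `a ≤ b` in `T`. -/
theorem deltaMeasure_Ico {T : Set ℝ} (hT : IsClosed T) {a b : ℝ} (ha : a ∈ T) (hb : b ∈ T) :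
    deltaMeasure T (Ico a b) = ENNReal.ofReal (b - a) := by
  classical
  set R : Set ℝ := {t | (t ∈ T ∧ t < sigma T t) ∧ t ∈ Ico a b} with hR
  have hdisj : R.PairwiseDisjoint (fun t => Ioo t (sigma T t)) := by
    intro x hx y hy hxy
    rw [Function.onFun, Set.disjoint_left]
    intro z hzx hzy
    rcases lt_or_gt_of_ne hxy with h | h
    · exact absurd (sigma_le hy.1.1 h) (not_le.2 (hzy.1.trans hzx.2))
    · exact absurd (sigma_le hx.1.1 h) (not_le.2 (hzx.1.trans hzy.2))
  have hcount : R.Countable := hdisj.countable_of_Ioo (fun x hx => hx.1.2)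
  have hgap : Ico a b \ T = ⋃ t ∈ R, Ioo t (sigma T t) := by
    ext z
    simp only [Set.mem_sdiff, mem_iUnion, exists_prop]
    constructor
    · rintro ⟨hz, hzT⟩
      have hne : (T ∩ Iic z).Nonempty := ⟨a, ha, hz.1⟩
      have hbd : BddAbove (T ∩ Iic z) := ⟨z, fun _ h => h.2⟩
      have hmem := (hT.inter isClosed_Iic).csSup_mem hne hbd
      set t := sSup (T ∩ Iic z) with ht
      have htz : t < z := lt_of_le_of_ne hmem.2 (fun h => hzT (h ▸ hmem.1))
      have hat : a ≤ t := le_csSup hbd ⟨ha, hz.1⟩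
      have hne' : (T ∩ Ici z).Nonempty := ⟨b, hb, hz.2.le⟩
      have hbd' : BddBelow (T ∩ Ici z) := ⟨z, fun _ h => h.2⟩
      have hmem' := (hT.inter isClosed_Ici).csInf_mem hne' hbd'
      have hlt : z < sInf (T ∩ Ici z) := lt_of_le_of_ne hmem'.2 (fun h => hzT (h ▸ hmem'.1))
      have hσ : sInf (T ∩ Ici z) ≤ sigma T t := by
        refine le_csInf ⟨b, hb, htz.trans hz.2⟩ ?_
        rintro w ⟨hwT, hw⟩
        refine csInf_le hbd' ⟨hwT, ?_⟩
        by_contra hwz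
        have hwz' : w ≤ z := (not_le.1 hwz).le
        exact absurd (le_csSup hbd ⟨hwT, hwz'⟩) (not_le.2 hw)
      exact ⟨t, ⟨⟨hmem.1, htz.trans (hlt.trans_le hσ)⟩, hat, htz.trans hz.2⟩, htz, hlt.trans_le hσ⟩
    · rintro ⟨t, ⟨⟨htT, -⟩, hat, htb⟩, htz, hzσ⟩
      refine ⟨⟨hat.trans htz.le, hzσ.trans_le (sigma_le hb htb)⟩, fun hzT => ?_⟩
      exact absurd (sigma_le hzT htz) (not_le.2 hzσ)
  have hvol : volume (Ico a b \ T) = ∑' t : R, ENNReal.ofReal (graininess T t) := by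
    rw [hgap, measure_biUnion hcount hdisj (fun _ _ => measurableSet_Ioo)]
    simp [Real.volume_Ioo, graininess]
  have hsum : (Measure.sum (fun t : {t : ℝ // t ∈ T ∧ t < sigma T t} =>
      ENNReal.ofReal (graininess T t) • Measure.dirac (t : ℝ))) (Ico a b)
        = ∑' t : R, ENNReal.ofReal (graininess T t) := by
    rw [Measure.sum_apply _ measurableSet_Ico]
    have h1 : ∀ t : {t : ℝ // t ∈ T ∧ t < sigma T t},
        (ENNReal.ofReal (graininess T t) • Measure.dirac (t : ℝ)) (Ico a b)
          = (Ico a b).indicator (fun t => ENNReal.ofReal (graininess T t)) t := by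
      intro t
      rw [Measure.smul_apply, Measure.dirac_apply' _ measurableSet_Ico]
      by_cases h : (t : ℝ) ∈ Ico a b <;> simp [h]
    simp_rw [h1]
    have h2 := tsum_subtype {t : ℝ | t ∈ T ∧ t < sigma T t}
      ((Ico a b).indicator (fun t => ENNReal.ofReal (graininess T t)))
    have h3 := tsum_subtype R (fun t => ENNReal.ofReal (graininess T t))
    rw [h3]
    refine h2.trans ?_
    rw [Set.indicator_indicator]
    rfl
  rw [deltaMeasure, Measure.add_apply, Measure.restrict_apply measurableSet_Ico, hsum, ← hvol,
    measure_inter_add_sdiff _ hT.measurableSet, Real.volume_Ico]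

variable {n m p : ℕ}

/-- `A` is regressive: `I + μ(t) A(t)` is invertible for all `t ∈ T`. -/
def Regressive (T : Set ℝ) (A : ℝ → Matrix (Fin n) (Fin n) ℝ) : Prop :=
  ∀ t ∈ T, IsUnit (1 + graininess T t • A t)

/-- `X` solves `X^Δ = A X`, `X(s) = I` on `T ∩ [s, ∞)`. -/
def IsFundamentalFrom (T : Set ℝ) (A : ℝ → Matrix (Fin n) (Fin n) ℝ) (s : ℝ)
    (X : ℝ → Matrix (Fin n) (Fin n) ℝ) : Prop :=
  X s = 1 ∧ ∀ t ∈ T, s ≤ t → HasDeltaDerivAt (T ∩ Ici s) X (A t * X t) t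

/-- The transition matrix `Φ_A(t, s)`: for `t ≥ s` the value at `t` of the (unique) solution of
`X^Δ = A X`, `X(s) = I`; for `t < s` the inverse of `Φ_A(s, t)`, which is the value at `t` of the
backward solution when `A` is regressive. -/
def transitionMatrix (T : Set ℝ) (A : ℝ → Matrix (Fin n) (Fin n) ℝ) (t s : ℝ) :
    Matrix (Fin n) (Fin n) ℝ :=
  if s ≤ t then Classical.epsilon (IsFundamentalFrom T A s) t
  else (Classical.epsilon (IsFundamentalFrom T A t) s)⁻¹

/-- The weighting pattern `G(t, σ(s)) = C(t) Φ_A(t, σ(s)) B(s)` as a function of `t` and `s`. -/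
def weightingPattern (T : Set ℝ) (A : ℝ → Matrix (Fin n) (Fin n) ℝ)
    (B : ℝ → Matrix (Fin n) (Fin m) ℝ) (C : ℝ → Matrix (Fin p) (Fin n) ℝ) (t s : ℝ) :
    Matrix (Fin p) (Fin m) ℝ :=
  C t * transitionMatrix T A t (sigma T s) * B s

/-- The right-hand side `A(t) x(t) + B(t) u(t)` of the state equation. -/
def stateField (A : ℝ → Matrix (Fin n) (Fin n) ℝ) (B : ℝ → Matrix (Fin n) (Fin m) ℝ)
    (u : ℝ → EuclideanSpace ℝ (Fin m)) (x : ℝ → EuclideanSpace ℝ (Fin n)) (t : ℝ) :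
    EuclideanSpace ℝ (Fin n) :=
  (A t).toEuclideanLin (x t) + (B t).toEuclideanLin (u t)

/-- `x` is a solution on `T ∩ [t₀, ∞)` of `x^Δ = A x + B u`, `x(t₀) = x₀`. -/
def IsSolution (T : Set ℝ) (A : ℝ → Matrix (Fin n) (Fin n) ℝ) (B : ℝ → Matrix (Fin n) (Fin m) ℝ)
    (t₀ : ℝ) (x₀ : EuclideanSpace ℝ (Fin n)) (u : ℝ → EuclideanSpace ℝ (Fin m))
    (x : ℝ → EuclideanSpace ℝ (Fin n)) : Prop :=
  x t₀ = x₀ ∧ ∀ t ∈ T, t₀ ≤ t → HasDeltaDerivAt (T ∩ Ici t₀) x (stateField A B u x t) t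

/-- `x` is a Carathéodory solution on `T ∩ [t₀, ∞)` of `x^Δ = A x + B u`, `x(t₀) = x₀`:
`x(t) = x₀ + ∫_{t₀}^t (A(s) x(s) + B(s) u(s)) Δs` for all `t ≥ t₀`, with integrable integrand. -/
def IsCaratheodorySolution (T : Set ℝ) (A : ℝ → Matrix (Fin n) (Fin n) ℝ)
    (B : ℝ → Matrix (Fin n) (Fin m) ℝ) (t₀ : ℝ) (x₀ : EuclideanSpace ℝ (Fin n))
    (u : ℝ → EuclideanSpace ℝ (Fin m)) (x : ℝ → EuclideanSpace ℝ (Fin n)) : Prop :=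
  ∀ t ∈ T, t₀ ≤ t → IntegrableOn (stateField A B u x) (Ico t₀ t) (deltaMeasure T) ∧
    x t = x₀ + ∫ s in Ico t₀ t, stateField A B u x s ∂(deltaMeasure T)

/-- The supremum of `‖f(t)‖` over `t ∈ T`, `t ≥ t₀`, as an element of `[0, ∞]`. -/
def supNormFrom {E : Type*} [NormedAddCommGroup E] (T : Set ℝ) (t₀ : ℝ) (f : ℝ → E) : ℝ≥0∞ :=
  ⨆ t ∈ T ∩ Ici t₀, ‖f t‖ₑ

/-- Uniform bounded-input, bounded-output stability of `x^Δ = A x + B u`, `y = C x`: one finite `η`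
such that, for every `t₀ ∈ T` and every (rd-continuous) input `u` on `T ∩ [t₀, ∞)`, the zero-state
response satisfies `sup_{t ≥ t₀} ‖y(t)‖ ≤ η sup_{t ≥ t₀} ‖u(t)‖`. -/
def UniformlyBIBOStable (T : Set ℝ) (A : ℝ → Matrix (Fin n) (Fin n) ℝ)
    (B : ℝ → Matrix (Fin n) (Fin m) ℝ) (C : ℝ → Matrix (Fin p) (Fin n) ℝ) : Prop :=
  ∃ η : ℝ≥0, ∀ t₀ ∈ T, ∀ u : ℝ → EuclideanSpace ℝ (Fin m), RdContinuous (T ∩ Ici t₀) u →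
    ∀ x : ℝ → EuclideanSpace ℝ (Fin n), IsSolution T A B t₀ 0 u x →
      supNormFrom T t₀ (fun t => (C t).toEuclideanLin (x t)) ≤ η * supNormFrom T t₀ u

/-- The same notion with all Δ-measurable inputs (which covers piecewise continuous inputs and the
signs of rd-continuous functions), solutions being understood in the sense of Carathéodory. -/
def UniformlyBIBOStableMeasurable (T : Set ℝ) (A : ℝ → Matrix (Fin n) (Fin n) ℝ)
    (B : ℝ → Matrix (Fin n) (Fin m) ℝ) (C : ℝ → Matrix (Fin p) (Fin n) ℝ) : Prop :=
  ∃ η : ℝ≥0, ∀ t₀ ∈ T, ∀ u : ℝ → EuclideanSpace ℝ (Fin m),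
    AEStronglyMeasurable u ((deltaMeasure T).restrict (Ici t₀)) →
    ∀ x : ℝ → EuclideanSpace ℝ (Fin n), IsCaratheodorySolution T A B t₀ 0 u x →
      supNormFrom T t₀ (fun t => (C t).toEuclideanLin (x t)) ≤ η * supNormFrom T t₀ u

/-- There is a finite `ρ` with `∫_τ^t ‖G(t, σ(s))‖ Δs ≤ ρ` for all `t ≥ τ` in `T`. -/
def WeightingPatternBounded (T : Set ℝ) (A : ℝ → Matrix (Fin n) (Fin n) ℝ)
    (B : ℝ → Matrix (Fin n) (Fin m) ℝ) (C : ℝ → Matrix (Fin p) (Fin n) ℝ) : Prop :=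
  ∃ ρ : ℝ≥0, ∀ τ ∈ T, ∀ t ∈ T, τ ≤ t →
    ∫⁻ s in Ico τ t, ‖weightingPattern T A B C t s‖ₑ ∂(deltaMeasure T) ≤ ρ

end TimeScale

end

open Set Filter Topology MeasureTheory
open scoped ENNReal NNReal
open scoped Matrix.Norms.L2Operator

noncomputable section

namespace TimeScale

/-! Fix `a ∈ T`. The retraction `lastPoint` sends `r ≥ a` to the last point of `T ∩ [a, ∞)` up to
`r` and is constant on each gap `[t, σ(t))`. Hence the Δ-measure on `[a, b)` is the image of
Lebesgue measure (`map_lastPoint_volume`), and the Δ-integral of `F` is `∫ F(lastPoint r) dr` over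
`[a, b]`. The linear theory thereby becomes ordinary analysis of integral equations: Peano–Baker
series, Grönwall, Fubini.

Regressivity makes the fundamental matrix `X` based at `a` invertible everywhere, so `Φ(t, σ(s)) =
X(t) X(σ(s))⁻¹` for `s < t`. Variation of constants and uniqueness then give `y(t) = ∫_a^t G(t,
σ(s)) u(s) Δs` for every zero-state Carathéodory solution whose input is bounded up to `t`
(`IsCaratheodorySolution.output_eq`). Classical solutions are Carathéodory solutions.

A bounded weighting pattern now gives stability by the triangle inequality. Conversely, fix `τ ≤ t`
and feed `u = f e_j` with `f` continuous and `|f| ≤ 1`. The `i`-th output is `∫ f G_ij`, and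
continuous `f` close to the sign of `G_ij` bring it close to `∫ |G_ij|`, so every entry has `L¹`
norm at most `η`; summing over the entries bounds the operator norm
(`weightingPatternBounded_of_continuous_test`). Continuous inputs are admissible in both definitions
of stability, so one argument serves both equivalences. -/

/-- `S` is a time scale with least element `a` that is unbounded above. -/
structure IsRay (S : Set ℝ) (a : ℝ) : Prop where
  closed : IsClosed S
  least : IsLeast S a
  unbounded : ¬ BddAbove S

theorem IsRay.of_inter_Ici {T : Set ℝ} {a : ℝ} (hT : IsClosed T) (hub : ¬ BddAbove T)
    (ha : a ∈ T) : IsRay (T ∩ Ici a) a where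
  closed := hT.inter isClosed_Ici
  least := ⟨⟨ha, self_mem_Ici⟩, fun _ h => h.2⟩
  unbounded := by
    rintro ⟨b, hb⟩
    refine hub ⟨max a b, fun x hx => ?_⟩
    rcases le_total x a with h | h
    · exact h.trans (le_max_left _ _)
    · exact (hb ⟨hx, h⟩).trans (le_max_right _ _)

/-- The retraction of `ℝ` onto `S` that maps `r ≥ a` to the last point of `S` up to `r`. -/
def lastPoint (S : Set ℝ) (a r : ℝ) : ℝ := sSup (S ∩ Iic (max a r))

/-! ### The retraction onto a time scale and rd-continuous functions. -/

section Ray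

variable {S : Set ℝ} {a : ℝ}

theorem IsRay.exists_gt (h : IsRay S a) (t : ℝ) : ∃ s ∈ S, t < s := by
  by_contra! hc
  exact h.unbounded ⟨t, fun s hs => hc s hs⟩

theorem IsRay.sigma_mem (h : IsRay S a) (t : ℝ) : sigma S t ∈ S := by
  obtain ⟨s, hs, hts⟩ := h.exists_gt t
  have : sigma S t ∈ closure (S ∩ Ioi t) :=
    csInf_mem_closure (s := S ∩ Ioi t) ⟨s, hs, hts⟩ ⟨t, fun _ hx => (mem_Ioi.1 hx.2).le⟩
  exact h.closed.closure_subset (closure_mono inter_subset_left this)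

theorem IsRay.le_sigma (h : IsRay S a) (t : ℝ) : t ≤ sigma S t := by
  obtain ⟨s, hs, hts⟩ := h.exists_gt t
  exact le_csInf (s := S ∩ Ioi t) ⟨s, hs, hts⟩ fun _ hx => (mem_Ioi.1 hx.2).le

theorem IsRay.exists_lt_of_sigma_lt (h : IsRay S a) {t r : ℝ} (hr : sigma S t < r) :
    ∃ s ∈ S, t < s ∧ s < r := by
  obtain ⟨s, hs, hts⟩ := h.exists_gt t
  obtain ⟨x, hx, hxr⟩ := exists_lt_of_csInf_lt (s := S ∩ Ioi t) ⟨s, hs, hts⟩ hr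
  exact ⟨x, hx.1, hx.2, hxr⟩

theorem IsRay.lastPoint_mem_inter (h : IsRay S a) (r : ℝ) :
    lastPoint S a r ∈ S ∩ Iic (max a r) :=
  (h.closed.inter isClosed_Iic).csSup_mem
    ⟨a, h.least.1, mem_Iic.2 (le_max_left _ _)⟩ ⟨max a r, fun _ hx => hx.2⟩

theorem IsRay.lastPoint_mem (h : IsRay S a) (r : ℝ) : lastPoint S a r ∈ S :=
  (h.lastPoint_mem_inter r).1

theorem IsRay.lastPoint_le (h : IsRay S a) {r : ℝ} (hr : a ≤ r) : lastPoint S a r ≤ r := by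
  simpa [max_eq_right hr] using (h.lastPoint_mem_inter r).2

theorem IsRay.le_lastPoint (_h : IsRay S a) {r s : ℝ} (hs : s ∈ S) (hsr : s ≤ r) :
    s ≤ lastPoint S a r :=
  le_csSup ⟨_, fun _ hx => hx.2⟩ ⟨hs, hsr.trans (le_max_right _ _)⟩

theorem IsRay.base_le_lastPoint (h : IsRay S a) (r : ℝ) : a ≤ lastPoint S a r :=
  h.least.2 (h.lastPoint_mem r)

theorem IsRay.lastPoint_self (h : IsRay S a) {t : ℝ} (ht : t ∈ S) : lastPoint S a t = t :=
  le_antisymm (h.lastPoint_le (h.least.2 ht)) (h.le_lastPoint ht le_rfl)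

theorem IsRay.lastPoint_eq (h : IsRay S a) {t r : ℝ} (ht : t ∈ S) (htr : t ≤ r)
    (hr : r < sigma S t) : lastPoint S a r = t := by
  refine le_antisymm ?_ (h.le_lastPoint ht htr)
  by_contra! hc
  exact absurd ((sigma_le (h.lastPoint_mem r) hc).trans
    (h.lastPoint_le ((h.least.2 ht).trans htr))) (not_le.2 hr)

theorem IsRay.lastPoint_lt_iff (h : IsRay S a) {p r : ℝ} (hp : p ∈ S) (hr : a ≤ r) :
    lastPoint S a r < p ↔ r < p := by
  constructor
  · intro hlt
    by_contra! hc
    exact absurd (h.le_lastPoint hp hc) (not_le.2 hlt)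
  · exact (h.lastPoint_le hr).trans_lt

theorem IsRay.lastPoint_mono (h : IsRay S a) : Monotone (lastPoint S a) := fun r _ hrs =>
  le_csSup ⟨_, fun _ hx => hx.2⟩
    ⟨h.lastPoint_mem r, (h.lastPoint_mem_inter r).2.trans (max_le_max le_rfl hrs)⟩

/-- The dichotomy behind right continuity of `F ∘ lastPoint`: either `r` lies in some `[t, σ(t))`,
where the retraction is constant just to the right of `r`, or `r` is itself a right-dense point of
`S`. -/
theorem IsRay.lt_sigma_lastPoint (h : IsRay S a) {r : ℝ} (hr : a ≤ r) :
    r < sigma S (lastPoint S a r) ∨ (RightDense S r ∧ lastPoint S a r = r) := by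
  rcases lt_or_ge r (sigma S (lastPoint S a r)) with hlt | hle
  · exact Or.inl hlt
  right
  have h1 := h.le_lastPoint (h.sigma_mem _) hle
  have hrd : sigma S (lastPoint S a r) = lastPoint S a r := le_antisymm h1 (h.le_sigma _)
  have heq : lastPoint S a r = r := by
    refine le_antisymm (h.lastPoint_le hr) ?_
    by_contra! hc
    obtain ⟨s, hs, h1, h2⟩ := h.exists_lt_of_sigma_lt (hrd.trans_lt hc)
    exact absurd (h.le_lastPoint hs h2.le) (not_le.2 h1)
  rw [heq] at hrd
  exact ⟨hrd, heq⟩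

theorem lastPoint_inter_Ici {r q : ℝ} (ha : a ≤ r) (hr : r ∈ S) (hq : r ≤ q) :
    lastPoint (S ∩ Ici r) r q = lastPoint S a q := by
  unfold lastPoint
  rw [max_eq_right hq, max_eq_right (ha.trans hq)]
  have hb : BddAbove (S ∩ Iic q) := ⟨q, fun _ hx => hx.2⟩
  refine le_antisymm (csSup_le_csSup hb ⟨r, ⟨hr, self_mem_Ici⟩, hq⟩ fun x hx => ⟨hx.1.1, hx.2⟩) ?_
  refine csSup_le ⟨r, hr, hq⟩ fun x hx => ?_
  have hb' : BddAbove (S ∩ Ici r ∩ Iic q) := ⟨q, fun _ hx => hx.2⟩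
  rcases le_total r x with h | h
  · exact le_csSup hb' ⟨⟨hx.1, h⟩, hx.2⟩
  · exact h.trans (le_csSup hb' ⟨⟨hr, self_mem_Ici⟩, hq⟩)

theorem sigma_inter_Ici {r t : ℝ} (hrt : r ≤ t) : sigma (S ∩ Ici r) t = sigma S t := by
  unfold sigma
  congr 1
  ext x
  simp only [mem_inter_iff, mem_Ici, mem_Ioi]
  constructor
  · rintro ⟨⟨h1, -⟩, h2⟩; exact ⟨h1, h2⟩
  · rintro ⟨h1, h2⟩; exact ⟨⟨h1, hrt.trans h2.le⟩, h2⟩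

theorem RdContinuous.inter_Ici {E : Type*} [TopologicalSpace E] {F : ℝ → E}
    (hF : RdContinuous S F) (r : ℝ) : RdContinuous (S ∩ Ici r) F := by
  intro t ht
  refine ⟨fun hrd => ?_, fun hld => ?_⟩
  · refine ((hF t ht.1).1 ?_).mono inter_subset_left
    rwa [RightDense, sigma_inter_Ici ht.2] at hrd
  · have hsub : S ∩ Ici r ∩ Iio t ⊆ S ∩ Iio t := fun x hx => ⟨hx.1.1, hx.2⟩
    obtain ⟨l, hl⟩ := (hF t ht.1).2 (closure_mono hsub hld)
    exact ⟨l, hl.mono_left (nhdsWithin_mono _ hsub)⟩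

theorem RdContinuous.map₂ {E F G : Type*} [TopologicalSpace E] [TopologicalSpace F]
    [TopologicalSpace G] {f : ℝ → E} {g : ℝ → F} (hf : RdContinuous S f) (hg : RdContinuous S g)
    {φ : E → F → G} (hφ : Continuous (Function.uncurry φ)) :
    RdContinuous S (fun t => φ (f t) (g t)) := by
  intro t ht
  refine ⟨fun hrd => ?_, fun hld => ?_⟩
  · exact hφ.continuousAt.tendsto.comp (((hf t ht).1 hrd).prodMk_nhds ((hg t ht).1 hrd))
  · obtain ⟨l, hl⟩ := (hf t ht).2 hld
    obtain ⟨k, hk⟩ := (hg t ht).2 hld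
    exact ⟨φ l k, (hφ.tendsto (l, k)).comp (hl.prodMk_nhds hk)⟩

theorem _root_.ContinuousOn.rdContinuous {E : Type*} [TopologicalSpace E] {f : ℝ → E}
    (hf : ContinuousOn f S) : RdContinuous S f := fun t ht =>
  ⟨fun _ => hf t ht, fun _ => ⟨f t, (hf t ht).mono_left (nhdsWithin_mono _ inter_subset_left)⟩⟩

theorem IsRay.tendsto_sigma_left (h : IsRay S a) {t : ℝ} (ht : t ∈ S) :
    Tendsto (sigma S) (𝓝[S ∩ Iio t] t) (𝓝[S] t) := by
  refine tendsto_nhdsWithin_iff.2 ⟨?_, Eventually.of_forall fun s => h.sigma_mem s⟩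
  refine tendsto_of_tendsto_of_tendsto_of_le_of_le' (f := sigma S) (g := fun s => s)
    (h := fun _ => t) (tendsto_id.mono_left nhdsWithin_le_nhds) tendsto_const_nhds
    (Eventually.of_forall fun s => h.le_sigma s) ?_
  filter_upwards [self_mem_nhdsWithin] with s hs
  exact sigma_le ht hs.2

theorem IsRay.tendsto_sigma_rightDense (h : IsRay S a) {t : ℝ}
    (hrd : RightDense S t) : Tendsto (sigma S) (𝓝[S] t) (𝓝[S] t) := by
  refine tendsto_nhdsWithin_iff.2 ⟨?_, Eventually.of_forall fun s => h.sigma_mem s⟩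
  rw [tendsto_order]
  constructor
  · intro b hb
    filter_upwards [nhdsWithin_le_nhds (Ioi_mem_nhds hb)] with s hs
    exact lt_of_lt_of_le hs (h.le_sigma s)
  · intro b hb
    obtain ⟨s', hs', h1, h2⟩ := h.exists_lt_of_sigma_lt (hrd.trans_lt hb)
    filter_upwards [nhdsWithin_le_nhds (Iio_mem_nhds h1)] with s hs
    exact (sigma_le hs' hs).trans_lt h2

/-- Needed for `s ↦ X(σ(s))⁻¹`. At a left-dense `t` the points `s < t` satisfy `s ≤ σ(s) ≤ t`, so
the left limit is `f t`, which may differ from `f (σ(t))`: only rd-continuity survives. -/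
theorem IsRay.rdContinuous_comp_sigma (h : IsRay S a) {E : Type*} [TopologicalSpace E]
    {f : ℝ → E} (hf : ContinuousOn f S) : RdContinuous S (fun t => f (sigma S t)) := by
  intro t ht
  refine ⟨fun hrd => ?_, fun _ => ⟨f t, (hf t ht).tendsto.comp (h.tendsto_sigma_left ht)⟩⟩
  have := (hf t ht).tendsto.comp (h.tendsto_sigma_rightDense hrd)
  rw [ContinuousWithinAt, show sigma S t = t from hrd]
  exact this

theorem IsRay.tendsto_lastPoint (h : IsRay S a) {t : ℝ} (ht : t ∈ S) :
    Tendsto (lastPoint S a) (𝓝[≥] t) (𝓝[S] t) := by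
  refine tendsto_nhdsWithin_iff.2 ⟨?_, Eventually.of_forall h.lastPoint_mem⟩
  refine tendsto_of_tendsto_of_tendsto_of_le_of_le' (g := fun _ => t) (h := fun s => s)
    tendsto_const_nhds (tendsto_id.mono_left nhdsWithin_le_nhds) ?_ ?_
  · filter_upwards [self_mem_nhdsWithin] with s hs using h.le_lastPoint ht hs
  · filter_upwards [self_mem_nhdsWithin] with s hs using h.lastPoint_le ((h.least.2 ht).trans hs)

/-- `f` is the pointwise limit of its values at the next point of the grid of mesh `1 / (k + 1)`.
This point lies strictly to the right of `r`, and each approximant factors through `ℤ`. -/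
theorem stronglyMeasurable_of_rightContinuous {E : Type*} [TopologicalSpace E]
    [TopologicalSpace.PseudoMetrizableSpace E] {f : ℝ → E}
    (hf : ∀ r, ContinuousWithinAt f (Ioi r) r) : StronglyMeasurable f := by
  have hlim : ∀ r : ℝ, Tendsto (fun k : ℕ => ((⌊((k : ℝ) + 1) * r⌋ : ℝ) + 1) / ((k : ℝ) + 1))
      atTop (𝓝[>] r) := by
    intro r
    refine tendsto_nhdsWithin_iff.2 ⟨?_, Eventually.of_forall fun k => ?_⟩
    · have h1 : Tendsto (fun k : ℕ => r + 1 / ((k : ℝ) + 1)) atTop (𝓝 r) := by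
        simpa using tendsto_const_nhds.add (tendsto_one_div_add_atTop_nhds_zero_nat (𝕜 := ℝ))
      refine tendsto_of_tendsto_of_tendsto_of_le_of_le tendsto_const_nhds h1
        (fun k => ?_) (fun k => ?_)
      · have hk : (0 : ℝ) < k + 1 := by positivity
        rw [le_div_iff₀ hk]
        nlinarith [Int.lt_floor_add_one (((k : ℝ) + 1) * r)]
      · have hk : (0 : ℝ) < k + 1 := by positivity
        simp only
        have h2 : (r + 1 / ((k : ℝ) + 1)) * ((k : ℝ) + 1) = r * ((k : ℝ) + 1) + 1 := by
          field_simp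
        rw [div_le_iff₀ hk, h2]
        nlinarith [Int.floor_le (((k : ℝ) + 1) * r)]
    · have hk : (0 : ℝ) < k + 1 := by positivity
      rw [mem_Ioi, lt_div_iff₀ hk]
      nlinarith [Int.lt_floor_add_one (((k : ℝ) + 1) * r)]
  refine stronglyMeasurable_of_tendsto atTop
    (f := fun (k : ℕ) r => f (((⌊((k : ℝ) + 1) * r⌋ : ℝ) + 1) / ((k : ℝ) + 1))) (fun k => ?_)
    (tendsto_pi_nhds.2 fun r => (hf r).tendsto.comp (hlim r))
  have h1 : StronglyMeasurable fun i : ℤ => f (((i : ℝ) + 1) / ((k : ℝ) + 1)) :=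
    StronglyMeasurable.of_discrete
  exact h1.comp_measurable (Int.measurable_floor.comp (measurable_const_mul _))

theorem IsRay.stronglyMeasurable_comp_lastPoint (h : IsRay S a) {E : Type*} [TopologicalSpace E]
    [TopologicalSpace.PseudoMetrizableSpace E] {F : ℝ → E} (hF : RdContinuous S F) :
    StronglyMeasurable (fun r => F (lastPoint S a r)) := by
  refine stronglyMeasurable_of_rightContinuous fun r => ?_
  rcases lt_or_ge r a with hra | hra
  · have hev : (fun q => F (lastPoint S a q)) =ᶠ[𝓝[>] r] fun _ => F (lastPoint S a r) := by
      filter_upwards [nhdsWithin_le_nhds (Iio_mem_nhds hra)] with q hq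
      simp only [lastPoint, max_eq_left hra.le, max_eq_left (le_of_lt (mem_Iio.1 hq))]
    exact tendsto_const_nhds.congr' hev.symm
  rcases h.lt_sigma_lastPoint hra with hlt | ⟨hrd, heq⟩
  · have hev : (fun q => F (lastPoint S a q)) =ᶠ[𝓝[>] r] fun _ => F (lastPoint S a r) := by
      filter_upwards [nhdsWithin_le_nhds (Iio_mem_nhds hlt), self_mem_nhdsWithin] with q hq hq'
      rw [h.lastPoint_eq (h.lastPoint_mem r) ((h.lastPoint_le hra).trans (le_of_lt hq')) hq]
    exact tendsto_const_nhds.congr' hev.symm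
  · have hr : r ∈ S := heq ▸ h.lastPoint_mem r
    have h1 := ((hF r hr).1 hrd).tendsto.comp (h.tendsto_lastPoint hr)
    rw [ContinuousWithinAt, heq]
    exact h1.mono_left (nhdsWithin_mono _ Ioi_subset_Ici_self)

theorem RdContinuous.exists_bound {E : Type*} [NormedAddCommGroup E] {F : ℝ → E}
    (h : IsRay S a) (hF : RdContinuous S F) (b : ℝ) :
    ∃ M : ℝ, 0 ≤ M ∧ ∀ t ∈ S, t ≤ b → ‖F t‖ ≤ M := by
  have hcpt : IsCompact (S ∩ Icc a b) := isCompact_Icc.inter_left h.closed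
  suffices ∃ M : ℝ, ∀ t ∈ S ∩ Icc a b, ‖F t‖ ≤ M by
    obtain ⟨M, hM⟩ := this
    exact ⟨max M 0, le_max_right _ _, fun t ht htb =>
      (hM t ⟨ht, h.least.2 ht, htb⟩).trans (le_max_left _ _)⟩
  refine hcpt.induction_on (p := fun s => ∃ M : ℝ, ∀ t ∈ s, ‖F t‖ ≤ M) ⟨0, by simp⟩ ?_ ?_ ?_
  · rintro s t hst ⟨M, hM⟩
    exact ⟨M, fun x hx => hM x (hst hx)⟩
  · rintro s t ⟨M, hM⟩ ⟨N, hN⟩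
    refine ⟨max M N, ?_⟩
    rintro x (hx | hx)
    · exact (hM x hx).trans (le_max_left _ _)
    · exact (hN x hx).trans (le_max_right _ _)
  · intro t ht
    suffices ∃ M : ℝ, ∀ᶠ s in 𝓝[S] t, ‖F s‖ ≤ M by
      obtain ⟨M, hM⟩ := this
      exact ⟨_, nhdsWithin_mono _ inter_subset_left hM, M, fun x hx => hx⟩
    by_cases hrd : RightDense S t
    · refine ⟨‖F t‖ + 1, ?_⟩
      have := ((hF t ht.1).1 hrd).norm
      exact (this.eventually (gt_mem_nhds (lt_add_one _))).mono fun s hs => hs.le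
    -- No point of `S` lies strictly between `t` and `σ(t)`, so only the left side of `t` needs
    -- care: it has a limit, or it contains no points of `S` near `t`.
    · have hlt : t < sigma S t := lt_of_le_of_ne (h.le_sigma t) (Ne.symm hrd)
      have hleft : ∃ M : ℝ, ∀ᶠ s in 𝓝[S ∩ Iio t] t, ‖F s‖ ≤ M := by
        by_cases hld : LeftDense S t
        · obtain ⟨l, hl⟩ := (hF t ht.1).2 hld
          exact ⟨‖l‖ + 1, (hl.norm.eventually (gt_mem_nhds (lt_add_one _))).mono fun s hs => hs.le⟩
        · have : 𝓝[S ∩ Iio t] t = ⊥ := by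
            rwa [LeftDense, mem_closure_iff_nhdsWithin_neBot, not_neBot] at hld
          exact ⟨0, by simp [this]⟩
      obtain ⟨M, hM⟩ := hleft
      refine ⟨max M ‖F t‖, ?_⟩
      rw [eventually_nhdsWithin_iff] at hM ⊢
      filter_upwards [hM, Iio_mem_nhds hlt] with s hs hsσ hsS
      rcases lt_trichotomy s t with h1 | h1 | h1
      · exact (hs ⟨hsS, h1⟩).trans (le_max_left _ _)
      · rw [h1]; exact le_max_right _ _
      · exact absurd (sigma_le hsS h1) (not_le.2 hsσ)

theorem IsRay.intervalIntegrable (h : IsRay S a) {E : Type*} [NormedAddCommGroup E]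
    {F : ℝ → E} (hF : RdContinuous S F) (c d : ℝ) :
    IntervalIntegrable (fun r => F (lastPoint S a r)) volume c d := by
  obtain ⟨M, -, hM⟩ := hF.exists_bound h (max a (max c d))
  refine (intervalIntegrable_const (c := M)).mono_fun
    (h.stronglyMeasurable_comp_lastPoint hF).aestronglyMeasurable ?_
  refine (ae_restrict_iff' measurableSet_uIoc).2 (Eventually.of_forall fun r hr => ?_)
  refine (hM _ (h.lastPoint_mem r) ?_).trans (le_abs_self _)
  exact (h.lastPoint_mem_inter r).2.trans (max_le_max le_rfl hr.2)

end Ray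

/-! ### Delta derivatives and the fundamental theorem of calculus. -/

section Calculus

variable {S : Set ℝ} {a : ℝ} {E : Type*} [NormedAddCommGroup E] [NormedSpace ℝ E]

/-- The defining inequality may be evaluated at `s = t` itself, and `ε` is arbitrary. The `+ 1` in
the choice of `ε` covers the right-dense case. -/
theorem HasDeltaDerivAt.apply_sigma {f : ℝ → E} {f' : E} {t : ℝ} (hf : HasDeltaDerivAt S f f' t)
    (ht : t ∈ S) : f (sigma S t) = f t + (sigma S t - t) • f' := by
  have h0 : ‖f (sigma S t) - f t - (sigma S t - t) • f'‖ ≤ 0 := by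
    refine le_of_forall_pos_le_add fun δ hδ => ?_
    have hpos : 0 < |sigma S t - t| + 1 := by positivity
    refine ((hf (δ / (|sigma S t - t| + 1)) (by positivity)).self_of_nhdsWithin ht).trans ?_
    rw [div_mul_eq_mul_div, zero_add, div_le_iff₀ hpos]
    nlinarith [abs_nonneg (sigma S t - t)]
  have := norm_le_zero_iff.1 h0
  rw [sub_sub, sub_eq_zero] at this
  exact this

theorem HasDeltaDerivAt.continuousWithinAt {f : ℝ → E} {f' : E} {t : ℝ}
    (hf : HasDeltaDerivAt S f f' t) (ht : t ∈ S) : ContinuousWithinAt f S t := by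
  have hσ := hf.apply_sigma ht
  have h1 : Tendsto (fun s => f (sigma S t) - f s - (sigma S t - s) • f') (𝓝[S] t) (𝓝 0) := by
    rw [Metric.tendsto_nhds]
    intro δ hδ
    have hpos : 0 < |sigma S t - t| + 1 := by positivity
    have hc : Tendsto (fun s => |sigma S t - s|) (𝓝[S] t) (𝓝 |sigma S t - t|) :=
      ((continuous_const.sub continuous_id).abs.tendsto t).mono_left nhdsWithin_le_nhds
    filter_upwards [hf (δ / (2 * (|sigma S t - t| + 1))) (by positivity),
      hc.eventually (gt_mem_nhds (lt_add_one _))] with s hs hs'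
    rw [dist_zero_right]
    refine hs.trans_lt ?_
    rw [div_mul_eq_mul_div, div_lt_iff₀ (by positivity)]
    nlinarith
  have h2 : Tendsto (fun s => (sigma S t - s) • f') (𝓝[S] t) (𝓝 ((sigma S t - t) • f')) :=
    (((continuous_const.sub continuous_id).smul continuous_const).tendsto t).mono_left
      nhdsWithin_le_nhds
  have h3 := (tendsto_const_nhds (x := f (sigma S t))).sub (h1.add h2)
  simp only [zero_add, sub_add_cancel, sub_sub_cancel] at h3
  rwa [hσ, add_sub_cancel_right] at h3

theorem HasDeltaDerivAt.sub {f g : ℝ → E} {f' g' : E} {t : ℝ} (hf : HasDeltaDerivAt S f f' t)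
    (hg : HasDeltaDerivAt S g g' t) : HasDeltaDerivAt S (fun s => f s - g s) (f' - g') t := by
  intro ε hε
  filter_upwards [hf (ε / 2) (half_pos hε), hg (ε / 2) (half_pos hε)] with s h1 h2
  have : f (sigma S t) - g (sigma S t) - (f s - g s) - (sigma S t - s) • (f' - g')
      = (f (sigma S t) - f s - (sigma S t - s) • f')
        - (g (sigma S t) - g s - (sigma S t - s) • g') := by
    rw [smul_sub]; abel
  rw [this]
  refine (norm_sub_le _ _).trans ((add_le_add h1 h2).trans_eq ?_)
  ring

/-- Real induction along `[a, b]`: the points of `S` where `‖w t - w a‖ ≤ ε (t - a)` form a closed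
set, and from each such point before `b` one can advance, by the jump to `σ(x)` or to a nearby point
of `S` when `x` is right-dense. -/
theorem IsRay.eq_of_hasDeltaDerivAt_zero (h : IsRay S a) {w : ℝ → E}
    (hw : ∀ t ∈ S, HasDeltaDerivAt S w 0 t) {b : ℝ} (hb : b ∈ S) : w b = w a := by
  have hcont : ContinuousOn w S := fun t ht => (hw t ht).continuousWithinAt ht
  have key : ∀ ε > 0, ‖w b - w a‖ ≤ ε * (b - a) := by
    intro ε hε
    have hclosed : IsClosed {t | t ∈ S ∧ ‖w t - w a‖ ≤ ε * (t - a)} :=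
      h.closed.isClosed_le (hcont.sub continuousOn_const).norm (by fun_prop)
    refine ((hclosed.inter isClosed_Icc).mem_of_ge_of_forall_exists_gt
      (a := a) (b := b) ⟨h.least.1, by simp⟩ (h.least.2 hb) ?_).2
    rintro x ⟨⟨hxS, hx⟩, hax, hxb⟩
    suffices ∃ y ∈ S, x < y ∧ y ≤ b ∧ ‖w y - w x‖ ≤ ε * (y - x) by
      obtain ⟨y, hyS, hxy, hyb, hy⟩ := this
      refine ⟨y, ⟨hyS, ?_⟩, hxy, hyb⟩
      calc ‖w y - w a‖ = ‖(w y - w x) + (w x - w a)‖ := by rw [sub_add_sub_cancel]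
        _ ≤ ε * (y - x) + ε * (x - a) := (norm_add_le _ _).trans (add_le_add hy hx)
        _ = ε * (y - a) := by ring
    rcases (h.le_sigma x).eq_or_lt with heq | hlt
    · have h1 := hw x hxS ε hε
      rw [← heq, eventually_nhdsWithin_iff, Metric.eventually_nhds_iff] at h1
      obtain ⟨δ, hδ, h1⟩ := h1
      obtain ⟨y, hyS, hxy, hy⟩ := h.exists_lt_of_sigma_lt
        (t := x) (r := min b (x + δ)) (by rw [← heq]; exact lt_min hxb (by linarith))
      have hyb := hy.trans_le (min_le_left _ _)
      have hyδ := hy.trans_le (min_le_right _ _)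
      refine ⟨y, hyS, hxy, hyb.le, ?_⟩
      have := h1 (y := y) (by rw [Real.dist_eq, abs_lt]; constructor <;> linarith) hyS
      rwa [smul_zero, sub_zero, norm_sub_rev, abs_sub_comm, abs_of_pos (sub_pos.2 hxy)] at this
    · refine ⟨sigma S x, h.sigma_mem x, hlt, sigma_le hb hxb, ?_⟩
      rw [(hw x hxS).apply_sigma hxS, smul_zero, add_zero, sub_self, norm_zero]
      exact mul_nonneg hε.le (sub_nonneg.2 hlt.le)
  have h0 : ‖w b - w a‖ ≤ 0 := by
    refine le_of_forall_pos_le_add fun δ hδ => ?_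
    have hba := sub_nonneg.2 (h.least.2 hb)
    have hpos : 0 < b - a + 1 := by linarith
    refine (key (δ / (b - a + 1)) (by positivity)).trans ?_
    rw [div_mul_eq_mul_div, zero_add, div_le_iff₀ hpos]
    nlinarith
  exact sub_eq_zero.1 (norm_le_zero_iff.1 h0)

theorem IsRay.hasDeltaDerivAt_of_integral (h : IsRay S a) {F x : ℝ → E}
    (hF : RdContinuous S F) {c : E} (hx : ∀ t ∈ S, x t = c + ∫ r in a..t, F (lastPoint S a r))
    [CompleteSpace E] {t : ℝ} (ht : t ∈ S) : HasDeltaDerivAt S x (F t) t := by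
  have hint := fun c d => h.intervalIntegrable hF c d
  have hdiff : ∀ s ∈ S, x (sigma S t) - x s - (sigma S t - s) • F t
      = ∫ r in s..sigma S t, (F (lastPoint S a r) - F t) := by
    intro s hs
    rw [hx _ (h.sigma_mem t), hx s hs, intervalIntegral.integral_sub (hint _ _)
      intervalIntegrable_const, intervalIntegral.integral_const,
      ← intervalIntegral.integral_interval_sub_left (hint a _) (hint a s)]
    abel
  intro ε hε
  rcases (h.le_sigma t).eq_or_lt with heq | hlt
  · have hc := (hF t ht).1 heq.symm
    rw [ContinuousWithinAt, Metric.tendsto_nhdsWithin_nhds] at hc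
    obtain ⟨δ, hδ, hc⟩ := hc ε hε
    filter_upwards [self_mem_nhdsWithin, nhdsWithin_le_nhds (Metric.ball_mem_nhds t hδ)]
      with s hs hsδ
    rw [hdiff s hs, ← heq]
    refine intervalIntegral.norm_integral_le_of_norm_le_const fun r hr => ?_
    rw [← dist_eq_norm]
    refine (hc (h.lastPoint_mem r) (lt_of_le_of_lt ?_ hsδ)).le
    rw [Real.dist_eq, Real.dist_eq]
    -- Both endpoints are in `S`, so the retraction keeps `r` between them and continuity of `F` at
    -- `t` applies.
    have hmin : min s t ∈ S := by rcases min_choice s t with h | h <;> rw [h] <;> assumption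
    have h1 := h.le_lastPoint hmin hr.1.le
    have h2 := (h.lastPoint_le ((h.least.2 hmin).trans hr.1.le)).trans hr.2
    rcases le_total s t with hst | hst
    · rw [min_eq_left hst] at h1
      rw [max_eq_right hst] at h2
      rw [abs_of_nonpos (by linarith), abs_of_nonpos (by linarith)]
      linarith
    · rw [min_eq_right hst] at h1
      rw [max_eq_left hst] at h2
      rw [abs_of_nonneg (by linarith), abs_of_nonneg (by linarith)]
      linarith
  · obtain ⟨M, hM0, hM⟩ := hF.exists_bound h t
    -- On the gap after `t` the integrand vanishes; between `s` and `t` it is at most `2 * M`. This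
    -- radius makes `2 * M * |t - s|` at most `ε (σ(t) - t)`, so no continuity at `t` is needed.
    have hδ : 0 < ε * (sigma S t - t) / (2 * M + 1) :=
      div_pos (mul_pos hε (sub_pos.2 hlt)) (by linarith)
    filter_upwards [self_mem_nhdsWithin, nhdsWithin_le_nhds (Metric.ball_mem_nhds t hδ),
      nhdsWithin_le_nhds (Iio_mem_nhds hlt)] with s hs hsδ hsσ
    have hst : s ≤ t := by
      by_contra! hc
      exact absurd (sigma_le hs hc) (not_le.2 hsσ)
    have hint' := fun c d => (hint c d).sub (intervalIntegrable_const (c := F t) (μ := volume))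
    have hzero : ∫ r in t..sigma S t, (F (lastPoint S a r) - F t) = 0 := by
      refine intervalIntegral.integral_zero_ae ?_
      filter_upwards [compl_mem_ae_iff.2 (measure_singleton (μ := volume) (sigma S t))] with r hr hr'
      rw [uIoc_of_le hlt.le] at hr'
      rw [h.lastPoint_eq ht hr'.1.le (lt_of_le_of_ne hr'.2 hr), sub_self]
    rw [hdiff s hs, ← intervalIntegral.integral_add_adjacent_intervals (hint' s t) (hint' t _),
      hzero, add_zero]
    refine (intervalIntegral.norm_integral_le_of_norm_le_const (C := 2 * M)
      fun r hr => ?_).trans ?_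
    · rw [uIoc_of_le hst] at hr
      have h1 := hM _ (h.lastPoint_mem r)
        ((h.lastPoint_le ((h.least.2 hs).trans hr.1.le)).trans hr.2)
      refine (norm_sub_le _ _).trans ?_
      linarith [hM t ht le_rfl]
    · rw [Metric.mem_ball, Real.dist_eq, abs_sub_comm, lt_div_iff₀ (by linarith)] at hsδ
      have h1 : ε * (sigma S t - t) ≤ ε * |sigma S t - s| :=
        mul_le_mul_of_nonneg_left (le_trans (by linarith) (le_abs_self _)) hε.le
      nlinarith [abs_nonneg (t - s)]

theorem IsRay.eq_add_integral (h : IsRay S a) [CompleteSpace E] {F x : ℝ → E}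
    (hF : RdContinuous S F) (hx : ∀ t ∈ S, HasDeltaDerivAt S x (F t) t) {t : ℝ} (ht : t ∈ S) :
    x t = x a + ∫ r in a..t, F (lastPoint S a r) := by
  have hw := h.eq_of_hasDeltaDerivAt_zero
    (w := fun t => x t - (0 + ∫ r in a..t, F (lastPoint S a r)))
    (fun s hs => by
      have h1 := h.hasDeltaDerivAt_of_integral hF (c := 0) (fun _ _ => rfl) hs
      simpa only [sub_self] using (hx s hs).sub h1) ht
  simp only [zero_add, intervalIntegral.integral_same, sub_zero] at hw
  rw [← hw, sub_add_cancel]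

end Calculus

/-! ### Linear integral equations: uniqueness, Peano–Baker series, cocycle. -/

section LinearEquation

variable {S : Set ℝ} {a : ℝ}

/-- Grönwall with `v` merely integrable, as Carathéodory solutions require. The primitive `f` of
`‖v‖` is monotone and dominates `‖x‖`; since `lastPoint r ≤ r`, the retraction disappears from the
estimate. -/
theorem IsRay.eq_zero_of_eq_integral (h : IsRay S a) {E : Type*} [NormedAddCommGroup E]
    [NormedSpace ℝ E] {x v : ℝ → E} {M b : ℝ} (hM0 : 0 ≤ M)
    (hv : IntervalIntegrable v volume a b) (hx : ∀ t ∈ S, t ≤ b → x t = ∫ r in a..t, v r)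
    (hvx : ∀ r ∈ Icc a b, ‖v r‖ ≤ M * ‖x (lastPoint S a r)‖) {t : ℝ} (ht : t ∈ S)
    (htb : t ≤ b) : x t = 0 := by
  have hab : a ≤ b := (h.least.2 ht).trans htb
  set w : ℝ → ℝ := (Ioc a b).indicator fun r => ‖v r‖ with hw
  have hw0 : ∀ r, 0 ≤ w r := fun r => indicator_nonneg (fun _ _ => norm_nonneg _) r
  have hwint : Integrable w :=
    (integrable_indicator_iff measurableSet_Ioc).2
      ((intervalIntegrable_iff_integrableOn_Ioc_of_le hab).1 hv).norm
  have hwi : ∀ c d, IntervalIntegrable w volume c d := fun c d => hwint.intervalIntegrable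
  set f : ℝ → ℝ := fun r => ∫ s in a..r, w s with hf
  have hfcont : Continuous f := intervalIntegral.continuous_primitive hwi a
  have hfmono : ∀ {r s}, r ≤ s → f r ≤ f s := by
    intro r s hrs
    have : f s - f r = ∫ q in r..s, w q :=
      intervalIntegral.integral_interval_sub_left (hwi _ _) (hwi _ _)
    have h2 : 0 ≤ ∫ q in r..s, w q := intervalIntegral.integral_nonneg hrs fun q _ => hw0 q
    linarith
  have hxf : ∀ s ∈ S, s ≤ b → ‖x s‖ ≤ f s := by
    intro s hs hsb
    rw [hx s hs hsb]
    refine (intervalIntegral.norm_integral_le_integral_norm (h.least.2 hs)).trans_eq ?_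
    refine intervalIntegral.integral_congr_ae (Eventually.of_forall fun r hr => ?_)
    rw [uIoc_of_le (h.least.2 hs)] at hr
    exact (indicator_of_mem (show r ∈ Ioc a b from ⟨hr.1, hr.2.trans hsb⟩) fun r => ‖v r‖).symm
  have hwf : ∀ r ∈ Icc a b, w r ≤ M * f r := by
    intro r hr
    have h1 : ‖v r‖ ≤ M * f r := (hvx r hr).trans (mul_le_mul_of_nonneg_left
      ((hxf _ (h.lastPoint_mem r) ((h.lastPoint_le hr.1).trans hr.2)).trans
        (hfmono (h.lastPoint_le hr.1))) hM0)
    exact (indicator_le_self' (fun _ _ => norm_nonneg _) r).trans h1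
  -- `f` need not be differentiable, so it is integrated once more: `g` is `C¹` with `g' = f ≤ M *
  -- g` and `g a = 0`.
  set g : ℝ → ℝ := fun r => ∫ s in a..r, f s with hg
  have hgderiv : ∀ r, HasDerivAt g (f r) r := fun r =>
    (hfcont.integral_hasStrictDerivAt a r).hasDerivAt
  have hfg : ∀ r ∈ Icc a b, f r ≤ M * g r := by
    intro r hr
    have h1 : f r ≤ ∫ s in a..r, M * f s :=
      intervalIntegral.integral_mono_on hr.1 (hwi _ _)
        ((hfcont.const_mul M).intervalIntegrable _ _) fun s hs => hwf s ⟨hs.1, hs.2.trans hr.2⟩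
    rwa [intervalIntegral.integral_const_mul] at h1
  have hf0 : ∀ r ∈ Icc a b, 0 ≤ f r := fun r hr =>
    intervalIntegral.integral_nonneg hr.1 fun q _ => hw0 q
  have hgz := eq_zero_of_abs_deriv_le_mul_abs_self_of_eq_zero_right (f := g) (f' := f) (K := M)
    (a := a) (b := b) (fun r _ => (hgderiv r).continuousAt.continuousWithinAt)
    (fun r _ => (hgderiv r).hasDerivWithinAt) (by simp [hg]) (fun r hr => by
      have hr' := Ico_subset_Icc_self hr
      rw [Real.norm_of_nonneg (hf0 r hr')]
      exact (hfg r hr').trans (mul_le_mul_of_nonneg_left (le_abs_self _) hM0))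
  have htab : t ∈ Icc a b := ⟨h.least.2 ht, htb⟩
  have := (hxf t ht htb).trans (hfg t htab)
  rw [hgz t htab, mul_zero] at this
  exact norm_le_zero_iff.1 this

/-- Backward uniqueness, the place where regressivity enters (`hreg`). A least zero `t > a` is
impossible: if `t = σ(s)` with `s < t`, then `hreg` makes `s` a zero; if `t` is left-dense, a
contraction estimate on a short interval gives earlier zeros. -/
theorem IsRay.eq_zero_of_apply_eq_zero (h : IsRay S a) {E : Type*} [NormedAddCommGroup E]
    [NormedSpace ℝ E] [CompleteSpace E] {x F : ℝ → E} {c : E} {M b : ℝ} (hM0 : 0 ≤ M)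
    (hF : RdContinuous S F) (hx : ∀ t ∈ S, x t = c + ∫ r in a..t, F (lastPoint S a r))
    (hFx : ∀ t ∈ S, t ≤ b → ‖F t‖ ≤ M * ‖x t‖)
    (hreg : ∀ t ∈ S, x t + (sigma S t - t) • F t = 0 → x t = 0)
    (hb : b ∈ S) (hxb : x b = 0) : c = 0 := by
  have hder : ∀ t ∈ S, HasDeltaDerivAt S x (F t) t := fun t ht =>
    h.hasDeltaDerivAt_of_integral hF hx ht
  have hcont : ContinuousOn x S := fun t ht => (hder t ht).continuousWithinAt ht
  set Z : Set ℝ := {t | t ∈ S ∩ Iic b ∧ x t = 0} with hZ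
  have hclosed : IsClosed Z :=
    (hcont.mono inter_subset_left).preimage_isClosed_of_isClosed
      (h.closed.inter isClosed_Iic) isClosed_singleton
  have hbdd : BddBelow Z := ⟨a, fun t ht => h.least.2 ht.1.1⟩
  have hmem : sInf Z ∈ Z := hclosed.csInf_mem ⟨b, ⟨hb, self_mem_Iic⟩, hxb⟩ hbdd
  set t := sInf Z with ht
  obtain ⟨⟨htS, htb⟩, hxt⟩ := hmem
  have hxa : x a = c := by rw [hx a h.least.1]; simp
  rcases (h.least.2 htS).eq_or_lt with hat | hat
  · rw [← hxa, hat, hxt]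
  exfalso
  have hmin : ∀ s ∈ S, s < t → x s ≠ 0 := fun s hs hst hxs =>
    absurd (csInf_le hbdd ⟨⟨hs, hst.le.trans htb⟩, hxs⟩) (not_le.2 hst)
  have hne : (S ∩ Iio t).Nonempty := ⟨a, h.least.1, hat⟩
  have hbd : BddAbove (S ∩ Iio t) := ⟨t, fun _ hs => (mem_Iio.1 hs.2).le⟩
  have hsS : sSup (S ∩ Iio t) ∈ S :=
    h.closed.closure_subset (closure_mono inter_subset_left (csSup_mem_closure hne hbd))
  have hst : sSup (S ∩ Iio t) ≤ t := csSup_le hne fun _ hs => (mem_Iio.1 hs.2).le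
  rcases hst.lt_or_eq with hlt | heq
  · set s := sSup (S ∩ Iio t) with hs
    have hσ : sigma S s = t := by
      refine le_antisymm (sigma_le htS hlt) ?_
      by_contra! hc
      obtain ⟨q, hq, h1, h2⟩ := h.exists_lt_of_sigma_lt hc
      exact absurd (le_csSup hbd ⟨hq, h2⟩) (not_le.2 h1)
    refine hmin s hsS hlt (hreg s hsS ?_)
    rw [← (hder s hsS).apply_sigma hsS, hσ, hxt]
  -- On an interval shorter than `1 / (M + 1)` the maximum of `‖x‖`, attained at `u`, is at most `M
  -- * |t - u| < 1` times itself, hence zero.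
  · have hδ : (0 : ℝ) < 1 / (M + 1) := by positivity
    obtain ⟨q, ⟨hqS, hqt⟩, hq⟩ := exists_lt_of_lt_csSup hne
      (show t - 1 / (M + 1) < sSup (S ∩ Iio t) by rw [heq]; linarith)
    have hcpt : IsCompact (S ∩ Icc q t) := isCompact_Icc.inter_left h.closed
    obtain ⟨u, ⟨huS, hqu, hut⟩, humax⟩ := hcpt.exists_isMaxOn ⟨q, hqS, le_rfl, le_of_lt hqt⟩
      (hcont.norm.mono inter_subset_left)
    have hux : x u = - ∫ r in u..t, F (lastPoint S a r) := by
      have h1 := hx t htS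
      rw [hxt, ← intervalIntegral.integral_add_adjacent_intervals
        (h.intervalIntegrable hF a u) (h.intervalIntegrable hF u t), ← add_assoc, ← hx u huS] at h1
      exact eq_neg_of_add_eq_zero_left h1.symm
    have hle : ‖x u‖ ≤ M * ‖x u‖ * |t - u| := by
      nth_rw 1 [hux]
      rw [norm_neg]
      refine intervalIntegral.norm_integral_le_of_norm_le_const fun r hr => ?_
      rw [uIoc_of_le hut] at hr
      have hlp := (h.lastPoint_le ((h.least.2 huS).trans hr.1.le)).trans hr.2
      refine (hFx _ (h.lastPoint_mem r) (hlp.trans htb)).trans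
        (mul_le_mul_of_nonneg_left (humax ⟨h.lastPoint_mem r, ?_, hlp⟩) hM0)
      exact hqu.trans (h.le_lastPoint huS hr.1.le)
    have hM1 : M * |t - u| < 1 := by
      rw [abs_of_nonneg (sub_nonneg.2 hut)]
      have h1 : t - u < 1 / (M + 1) := by linarith
      rw [lt_div_iff₀ (by linarith)] at h1
      nlinarith [sub_nonneg.2 hut]
    have hu0 : ‖x u‖ = 0 := by
      by_contra hne
      have : 0 < ‖x u‖ := lt_of_le_of_ne (norm_nonneg _) (Ne.symm hne)
      nlinarith
    have hq0 : ‖x q‖ ≤ ‖x u‖ := humax ⟨hqS, le_rfl, le_of_lt hqt⟩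
    exact hmin q hqS hqt (norm_le_zero_iff.1 (hq0.trans_eq hu0))

variable {R : Type*} [NormedRing R] [NormedAlgebra ℝ R]

/-- `X` solves the integral form `X(t) = 1 + ∫_a^t A(s) X(s) Δs` of `X^Δ = A X`, `X(a) = 1`. -/
structure IsIntegralFundamental (S : Set ℝ) (a : ℝ) (A X : ℝ → R) : Prop where
  continuousOn : ContinuousOn X S
  eq_integral : ∀ t ∈ S, X t = 1 + ∫ r in a..t, A (lastPoint S a r) * X (lastPoint S a r)

theorem IsIntegralFundamental.rdContinuous_mul {A X : ℝ → R} (hX : IsIntegralFundamental S a A X)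
    (hA : RdContinuous S A) : RdContinuous S (fun t => A t * X t) :=
  hA.map₂ hX.continuousOn.rdContinuous continuous_mul

theorem IsIntegralFundamental.apply_base {A X : ℝ → R} (hX : IsIntegralFundamental S a A X)
    (h : IsRay S a) : X a = 1 := by
  simpa using hX.eq_integral a h.least.1

/-- The terms of the Peano–Baker series. -/
def peanoBakerTerm (S : Set ℝ) (a : ℝ) (A : ℝ → R) : ℕ → ℝ → R
  | 0 => fun _ => 1
  | k + 1 => fun t =>
      ∫ r in a..t, A (lastPoint S a r) * peanoBakerTerm S a A k (lastPoint S a r)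

theorem IsRay.continuous_peanoBakerTerm (h : IsRay S a) {A : ℝ → R} (hA : RdContinuous S A) :
    ∀ k, Continuous (peanoBakerTerm S a A k)
  | 0 => continuous_const
  | k + 1 => intervalIntegral.continuous_primitive (fun c d => h.intervalIntegrable
      (hA.map₂ (h.continuous_peanoBakerTerm hA k).continuousOn.rdContinuous continuous_mul) c d) a

/-- The classical factorial bound survives because `lastPoint r ≤ r`. The factor `‖(1 : R)‖` stays
since `R` may be the zero ring, as for matrices of size zero. -/
theorem IsRay.norm_peanoBakerTerm_le (h : IsRay S a) {A : ℝ → R}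
    {M b : ℝ} (hM0 : 0 ≤ M) (hM : ∀ t ∈ S, t ≤ b → ‖A t‖ ≤ M) (k : ℕ) :
    ∀ t ∈ Icc a b, ‖peanoBakerTerm S a A k t‖ ≤ ‖(1 : R)‖ * ((M * (t - a)) ^ k / k.factorial) := by
  induction k with
  | zero => intro t _; simp [peanoBakerTerm]
  | succ k ih =>
    intro t ht
    have hmon : ∀ r ∈ Icc a t, ‖A (lastPoint S a r) * peanoBakerTerm S a A k (lastPoint S a r)‖ ≤
        ‖(1 : R)‖ * M ^ (k + 1) / k.factorial * (r - a) ^ k := by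
      intro r hr
      have hlp := h.lastPoint_le hr.1
      have hlp' := h.base_le_lastPoint r
      have hrb := hr.2.trans ht.2
      calc _ ≤ M * (‖(1 : R)‖ * ((M * (lastPoint S a r - a)) ^ k / k.factorial)) :=
            (norm_mul_le _ _).trans (mul_le_mul (hM _ (h.lastPoint_mem r) (hlp.trans hrb))
              (ih _ ⟨hlp', hlp.trans hrb⟩) (norm_nonneg _) hM0)
        _ ≤ M * (‖(1 : R)‖ * ((M * (r - a)) ^ k / k.factorial)) := by
            have h0 : 0 ≤ M * (lastPoint S a r - a) := mul_nonneg hM0 (sub_nonneg.2 hlp')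
            gcongr
        _ = _ := by rw [mul_pow]; ring
    have hint : ∫ r in a..t, ‖(1 : R)‖ * M ^ (k + 1) / k.factorial * (r - a) ^ k =
        ‖(1 : R)‖ * ((M * (t - a)) ^ (k + 1) / (k + 1).factorial) := by
      rw [intervalIntegral.integral_const_mul,
        intervalIntegral.integral_comp_sub_right (fun r => r ^ k), integral_pow, sub_self,
        Nat.factorial_succ, mul_pow]
      have : (k.factorial : ℝ) ≠ 0 := by positivity
      have : (k : ℝ) + 1 ≠ 0 := by positivity
      push_cast
      field_simp
      simp
    rw [← hint]
    refine intervalIntegral.norm_integral_le_of_norm_le ht.1 (Eventually.of_forall fun r hr =>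
      hmon r ⟨hr.1.le, hr.2⟩) (Continuous.intervalIntegrable (by fun_prop) _ _)

theorem IsRay.exists_isIntegralFundamental (h : IsRay S a) [CompleteSpace R] {A : ℝ → R}
    (hA : RdContinuous S A) : ∃ X, IsIntegralFundamental S a A X := by
  set u : ℝ → ℝ → ℕ → ℝ := fun M b k => ‖(1 : R)‖ * ((M * (b - a)) ^ k / k.factorial) with hu
  have husum : ∀ M b, Summable (u M b) := fun M b =>
    (Real.summable_pow_div_factorial _).mul_left _
  have hbound : ∀ {M b : ℝ}, 0 ≤ M → (∀ t ∈ S, t ≤ b → ‖A t‖ ≤ M) → ∀ k, ∀ t ∈ Icc a b,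
      ‖peanoBakerTerm S a A k t‖ ≤ u M b k := by
    intro M b hM0 hM k t ht
    refine (h.norm_peanoBakerTerm_le hM0 hM k t ht).trans ?_
    have h0 : 0 ≤ M * (t - a) := mul_nonneg hM0 (sub_nonneg.2 ht.1)
    simp only [hu]
    gcongr
    exact ht.2
  refine ⟨fun t => ∑' k, peanoBakerTerm S a A k t, ?_, ?_⟩
  · intro t ht
    obtain ⟨M, hM0, hM⟩ := hA.exists_bound h (t + 1)
    have hc : ContinuousOn (fun t => ∑' k, peanoBakerTerm S a A k t) (Icc a (t + 1)) :=
      continuousOn_tsum (fun k => (h.continuous_peanoBakerTerm hA k).continuousOn)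
        (husum M (t + 1)) (hbound hM0 hM)
    refine (hc t ⟨h.least.2 ht, (lt_add_one t).le⟩).mono_of_mem_nhdsWithin ?_
    filter_upwards [self_mem_nhdsWithin, nhdsWithin_le_nhds (Iio_mem_nhds (lt_add_one t))]
      with s hs hs' using ⟨h.least.2 hs, le_of_lt hs'⟩
  · intro t ht
    have hat := h.least.2 ht
    obtain ⟨M, hM0, hM⟩ := hA.exists_bound h t
    have hsum : ∀ s ∈ Icc a t, Summable fun k => peanoBakerTerm S a A k s := fun s hs =>
      Summable.of_norm_bounded (husum M t) fun k => hbound hM0 hM k s hs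
    have hmem : ∀ r ∈ uIoc a t, lastPoint S a r ∈ Icc a t := by
      intro r hr
      rw [uIoc_of_le hat] at hr
      exact ⟨h.base_le_lastPoint r, (h.lastPoint_le hr.1.le).trans hr.2⟩
    -- Dominated convergence allows termwise integration, which shifts the series by one index and
    -- yields the integral equation.
    have key := intervalIntegral.hasSum_integral_of_dominated_convergence (μ := volume) (a := a)
      (b := t) (F := fun k r => A (lastPoint S a r) * peanoBakerTerm S a A k (lastPoint S a r))
      (f := fun r => A (lastPoint S a r) * ∑' k, peanoBakerTerm S a A k (lastPoint S a r))
      (fun k _ => M * u M t k)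
      (fun k => (h.stronglyMeasurable_comp_lastPoint (hA.map₂
        (h.continuous_peanoBakerTerm hA k).continuousOn.rdContinuous
        continuous_mul)).aestronglyMeasurable)
      (fun k => Eventually.of_forall fun r hr => (norm_mul_le _ _).trans
        (mul_le_mul (hM _ (h.lastPoint_mem r) (hmem r hr).2) (hbound hM0 hM k _ (hmem r hr))
          (norm_nonneg _) hM0))
      (Eventually.of_forall fun r hr => (husum M t).mul_left M)
      intervalIntegrable_const
      (Eventually.of_forall fun r hr => (hsum _ (hmem r hr)).hasSum.mul_left _)
    have h1 := (hsum t ⟨hat, le_rfl⟩).tsum_eq_zero_add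
    rw [h1, ← key.tsum_eq]
    rfl

theorem IsIntegralFundamental.mul_const {A X : ℝ → R} [CompleteSpace R]
    (hX : IsIntegralFundamental S a A X) (h : IsRay S a)
    (hA : RdContinuous S A) (N : R) {t : ℝ} (ht : t ∈ S) :
    X t * N = N + ∫ r in a..t, A (lastPoint S a r) * (X (lastPoint S a r) * N) := by
  have h1 := ((ContinuousLinearMap.mul ℝ R).flip N).intervalIntegral_comp_comm
    (h.intervalIntegrable (hX.rdContinuous_mul hA) a t)
  simp only [ContinuousLinearMap.flip_apply, ContinuousLinearMap.mul_apply', mul_assoc] at h1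
  rw [hX.eq_integral t ht, add_mul, one_mul, h1]

theorem IsIntegralFundamental.eq_zero_of_mul_eq_zero {A X : ℝ → R} [CompleteSpace R]
    (hX : IsIntegralFundamental S a A X) (h : IsRay S a) (hA : RdContinuous S A)
    (hreg : ∀ t ∈ S, IsUnit (1 + (sigma S t - t) • A t)) {t : ℝ} (ht : t ∈ S) {N : R}
    (hN : X t * N = 0) : N = 0 := by
  obtain ⟨M, hM0, hM⟩ := hA.exists_bound h t
  have hXN : ContinuousOn (fun s => X s * N) S := hX.continuousOn.mul continuousOn_const
  refine h.eq_zero_of_apply_eq_zero (x := fun s => X s * N) (F := fun s => A s * (X s * N))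
    hM0 (hA.map₂ hXN.rdContinuous continuous_mul) (fun s hs => hX.mul_const h hA N hs)
    (fun s hs hst => (norm_mul_le _ _).trans
      (mul_le_mul_of_nonneg_right (hM s hs hst) (norm_nonneg _))) (fun s hs h0 => ?_) ht hN
  have h1 : (1 + (sigma S s - s) • A s) * (X s * N) = 0 := by
    rw [add_mul, one_mul, smul_mul_assoc]
    exact h0
  exact (hreg s hs).mul_right_eq_zero.1 h1

/-- The cocycle property of fundamental solutions. -/
theorem IsIntegralFundamental.mul_eq {A X Y : ℝ → R} [CompleteSpace R]
    (hX : IsIntegralFundamental S a A X) (h : IsRay S a) (hA : RdContinuous S A) {r : ℝ}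
    (hr : r ∈ S) (hY : IsIntegralFundamental (S ∩ Ici r) r A Y) {t : ℝ} (ht : t ∈ S)
    (hrt : r ≤ t) : Y t * X r = X t := by
  have h' : IsRay (S ∩ Ici r) r := IsRay.of_inter_Ici h.closed h.unbounded hr
  have hA' := hA.inter_Ici r
  obtain ⟨M, hM0, hM⟩ := hA.exists_bound h t
  have hcY : ContinuousOn (fun s => Y s * X r) (S ∩ Ici r) :=
    hY.continuousOn.mul continuousOn_const
  have hcX : ContinuousOn X (S ∩ Ici r) := hX.continuousOn.mono inter_subset_left
  have hiY := fun c d => h'.intervalIntegrable (hA'.map₂ hcY.rdContinuous continuous_mul) c d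
  have hiX := fun c d => h'.intervalIntegrable (hA'.map₂ hcX.rdContinuous continuous_mul) c d
  refine sub_eq_zero.1 (h'.eq_zero_of_eq_integral (x := fun s => Y s * X r - X s)
    (b := t) hM0 ((hiY r t).sub (hiX r t)) (fun s hs hst => ?_) (fun q hq => ?_) ⟨ht, hrt⟩ le_rfl)
  · rw [intervalIntegral.integral_sub (hiY r s) (hiX r s)]
    rw [hY.mul_const h' hA' (X r) hs]
    have h1 : X s = X r + ∫ q in r..s, A (lastPoint (S ∩ Ici r) r q) *
        X (lastPoint (S ∩ Ici r) r q) := by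
      have h2 : ∫ q in r..s, A (lastPoint (S ∩ Ici r) r q) * X (lastPoint (S ∩ Ici r) r q)
          = ∫ q in r..s, A (lastPoint S a q) * X (lastPoint S a q) := by
        refine intervalIntegral.integral_congr fun q hq => ?_
        rw [uIcc_of_le hs.2] at hq
        simp only [lastPoint_inter_Ici (h.least.2 hr) hr hq.1]
      have hi := fun c d => h.intervalIntegrable (hX.rdContinuous_mul hA) c d
      rw [h2, hX.eq_integral s hs.1, hX.eq_integral r hr, add_assoc,
        intervalIntegral.integral_add_adjacent_intervals (hi a r) (hi r s)]
    conv_lhs => rw [h1]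
    abel
  · rw [← mul_sub]
    exact (norm_mul_le _ _).trans (mul_le_mul_of_nonneg_right
      (hM _ (h'.lastPoint_mem q).1 ((h'.lastPoint_le hq.1).trans hq.2)) (norm_nonneg _))

end LinearEquation

/-! ### Variation of constants for an integrable forcing term. -/

section VariationOfConstants

variable {S : Set ℝ} {a : ℝ} {R : Type*} [NormedRing R] [NormedAlgebra ℝ R]
  {E : Type*} [NormedAddCommGroup E] [NormedSpace ℝ E]

theorem IsRay.intervalIntegrable_apply_sigma (h : IsRay S a) {Y : ℝ → R}
    (hY : ContinuousOn Y S) (φ : R →L[ℝ] E →L[ℝ] E) {b : ℝ → E} {t : ℝ}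
    (hb : IntervalIntegrable b volume a t) :
    IntervalIntegrable (fun s => φ (Y (sigma S (lastPoint S a s))) (b s)) volume a t := by
  have hW := h.rdContinuous_comp_sigma hY
  obtain ⟨K, hK0, hK⟩ := hW.exists_bound h (max a t)
  have hm : AEStronglyMeasurable (fun s => φ (Y (sigma S (lastPoint S a s))))
      (volume.restrict (uIoc a t)) :=
    φ.continuous.comp_aestronglyMeasurable
      (h.stronglyMeasurable_comp_lastPoint hW).aestronglyMeasurable
  have hc : Continuous fun p : (E →L[ℝ] E) × E => p.1 p.2 := by fun_prop
  refine (hb.norm.const_mul (‖φ‖ * K)).mono_fun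
    (hc.comp_aestronglyMeasurable (hm.prodMk hb.def'.1)) ?_
  refine (ae_restrict_iff' measurableSet_uIoc).2 (Eventually.of_forall fun r hr => ?_)
  have h1 := hK _ (h.lastPoint_mem r) ((h.lastPoint_mem_inter r).2.trans
    (max_le (le_max_left _ _) hr.2))
  refine le_trans ?_ (le_abs_self _)
  refine (φ.le_opNorm₂ _ _).trans ?_
  gcongr

/-- Variation of constants. -/
theorem IsIntegralFundamental.variation_of_constants [CompleteSpace R] [CompleteSpace E]
    {A X Y : ℝ → R} (h : IsRay S a)
    (hA : RdContinuous S A) (hX : IsIntegralFundamental S a A X) (hY : ContinuousOn Y S)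
    (hXY : ∀ t ∈ S, X t * Y t = 1) (φ : R →L[ℝ] E →L[ℝ] E) (hφ1 : ∀ v, φ 1 v = v)
    (hφ : ∀ M N v, φ (M * N) v = φ M (φ N v)) {b : ℝ → E} {t : ℝ} (ht : t ∈ S)
    (hb : IntervalIntegrable b volume a t) :
    φ (X t) (∫ s in a..t, φ (Y (sigma S (lastPoint S a s))) (b s)) =
      (∫ s in a..t, b s) + ∫ q in a..t, φ (A (lastPoint S a q)) (φ (X (lastPoint S a q))
        (∫ s in a..lastPoint S a q, φ (Y (sigma S (lastPoint S a s))) (b s))) := by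
  have hat := h.least.2 ht
  set α : ℝ → R := fun q => A (lastPoint S a q) * X (lastPoint S a q) with hα
  set β : ℝ → E := fun s => φ (Y (sigma S (lastPoint S a s))) (b s) with hβ
  have hαi : ∀ c d, IntervalIntegrable α volume c d :=
    fun c d => h.intervalIntegrable (hX.rdContinuous_mul hA) c d
  have hβi : IntervalIntegrable β volume a t :=
    h.intervalIntegrable_apply_sigma hY φ hb
  have hlpm : Measurable (lastPoint S a) := h.lastPoint_mono.measurable
  have hD : MeasurableSet {p : ℝ × ℝ | lastPoint S a p.1 < lastPoint S a p.2} :=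
    measurableSet_lt (hlpm.comp measurable_fst) (hlpm.comp measurable_snd)
  -- The formula is Fubini on this region. Up to null sets it is `q > σ(lastPoint s)` for fixed `s`,
  -- and `s < lastPoint q` for fixed `q`.
  set f : ℝ → ℝ → E := fun s q => {p : ℝ × ℝ | lastPoint S a p.1 < lastPoint S a p.2}.indicator
    (fun p => φ (α p.2) (β p.1)) (s, q) with hf
  have hαI : Integrable α (volume.restrict (Ioc a t)) :=
    (intervalIntegrable_iff_integrableOn_Ioc_of_le hat).1 (hαi a t)
  have hβI : Integrable β (volume.restrict (Ioc a t)) :=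
    (intervalIntegrable_iff_integrableOn_Ioc_of_le hat).1 hβi
  have hfI : Integrable (Function.uncurry f)
      ((volume.restrict (Ioc a t)).prod (volume.restrict (Ioc a t))) := by
    refine Integrable.indicator (f := fun p : ℝ × ℝ => φ (α p.2) (β p.1)) ?_ hD
    have hc : Continuous fun p : R × E => φ p.1 p.2 := by fun_prop
    refine ((hβI.norm.mul_prod hαI.norm).const_mul ‖φ‖).mono'
      (hc.comp_aestronglyMeasurable (hαI.1.comp_snd.prodMk hβI.1.comp_fst))
      (Eventually.of_forall fun p => ?_)
    refine (φ.le_opNorm₂ _ _).trans_eq ?_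
    ring
  have hswap := integral_integral_swap hfI
  -- With `c = σ(lastPoint s)`, integrating `α` over `[c, t]` gives `X t - X c`, and `X c * Y c = 1`
  -- turns the second term into `b s`.
  have hleft : ∫ s in Ioc a t, ∫ q in Ioc a t, f s q =
      ∫ s in Ioc a t, (φ (X t) (β s) - b s) := by
    refine integral_congr_ae ?_
    filter_upwards [ae_restrict_mem measurableSet_Ioc,
      ae_restrict_of_ae (compl_mem_ae_iff.2 (measure_singleton (μ := volume) t))] with s hs hst
    have hst' : s < t := lt_of_le_of_ne hs.2 hst
    set c := sigma S (lastPoint S a s) with hc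
    have hcS : c ∈ S := h.sigma_mem _
    have hct : c ≤ t := sigma_le ht ((h.lastPoint_lt_iff ht hs.1.le).2 hst')
    have hac : a ≤ c := h.least.2 hcS
    have h1 : ∫ q in Ioc a t, f s q = ∫ q in Ioc a t, (Ioc c t).indicator
        (fun q => φ (α q) (β s)) q := by
      refine integral_congr_ae ?_
      filter_upwards [ae_restrict_mem measurableSet_Ioc,
        ae_restrict_of_ae (compl_mem_ae_iff.2 (measure_singleton (μ := volume) c))] with q hq hqc
      rcases lt_or_gt_of_ne (show q ≠ c from hqc) with hlt | hgt
      · have h2 : ¬ lastPoint S a s < lastPoint S a q := fun hc' =>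
          absurd ((sigma_le (h.lastPoint_mem q) hc').trans (h.lastPoint_le hq.1.le))
            (not_le.2 hlt)
        rw [hf, indicator_of_notMem (s := Ioc c t) (fun h3 => absurd h3.1 hlt.le.not_gt)]
        exact indicator_of_notMem (by simpa using h2) _
      · have h2 : lastPoint S a s < lastPoint S a q := by
          rcases (h.le_sigma (lastPoint S a s)).lt_or_eq with h3 | h3
          · exact h3.trans_le (h.le_lastPoint hcS hgt.le)
          · obtain ⟨u, hu, h4, h5⟩ := h.exists_lt_of_sigma_lt hgt
            exact h4.trans_le (h.le_lastPoint hu h5.le)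
        rw [indicator_of_mem (show q ∈ Ioc c t from ⟨hgt, hq.2⟩)]
        exact indicator_of_mem (s := {p : ℝ × ℝ | lastPoint S a p.1 < lastPoint S a p.2})
          (a := (s, q)) h2 _
    rw [h1, integral_indicator measurableSet_Ioc, Measure.restrict_restrict measurableSet_Ioc,
      inter_eq_self_of_subset_left (Ioc_subset_Ioc_left hac),
      ← intervalIntegral.integral_of_le hct]
    have h2 := (φ.flip (β s)).intervalIntegral_comp_comm (hαi c t)
    simp only [ContinuousLinearMap.flip_apply] at h2
    have h3 : X t - X c = ∫ q in c..t, α q := by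
      rw [hX.eq_integral t ht, hX.eq_integral c hcS, add_sub_add_left_eq_sub]
      exact intervalIntegral.integral_interval_sub_left (hαi _ _) (hαi _ _)
    rw [h2, ← h3, map_sub, sub_apply]
    congr 1
    rw [hβ, ← hφ, hXY c hcS, hφ1]
  have hright : ∫ q in Ioc a t, ∫ s in Ioc a t, f s q =
      ∫ q in Ioc a t, φ (A (lastPoint S a q)) (φ (X (lastPoint S a q))
        (∫ s in a..lastPoint S a q, β s)) := by
    refine integral_congr_ae ?_
    filter_upwards [ae_restrict_mem measurableSet_Ioc] with q hq
    set c := lastPoint S a q with hc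
    have hcS : c ∈ S := h.lastPoint_mem q
    have hct : c ≤ t := (h.lastPoint_le hq.1.le).trans hq.2
    have hac : a ≤ c := h.least.2 hcS
    have h1 : ∫ s in Ioc a t, f s q = ∫ s in Ioc a t, (Ioc a c).indicator
        (fun s => φ (α q) (β s)) s := by
      refine integral_congr_ae ?_
      filter_upwards [ae_restrict_mem measurableSet_Ioc,
        ae_restrict_of_ae (compl_mem_ae_iff.2 (measure_singleton (μ := volume) c))] with s hs hsc
      have hiff := h.lastPoint_lt_iff hcS hs.1.le
      rcases lt_or_gt_of_ne (show s ≠ c from hsc) with hlt | hgt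
      · rw [indicator_of_mem (show s ∈ Ioc a c from ⟨hs.1, hlt.le⟩)]
        exact indicator_of_mem (s := {p : ℝ × ℝ | lastPoint S a p.1 < lastPoint S a p.2})
          (a := (s, q)) (hiff.2 hlt) _
      · rw [indicator_of_notMem (s := Ioc a c) (fun h3 => absurd h3.2 hgt.not_ge)]
        exact indicator_of_notMem (s := {p : ℝ × ℝ | lastPoint S a p.1 < lastPoint S a p.2})
          (a := (s, q)) (fun h3 => absurd (hiff.1 h3) hgt.not_gt) _
    rw [h1, integral_indicator measurableSet_Ioc, Measure.restrict_restrict measurableSet_Ioc,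
      inter_eq_self_of_subset_left (Ioc_subset_Ioc_right hct),
      ← intervalIntegral.integral_of_le hac]
    have h2 := (φ (α q)).intervalIntegral_comp_comm
      (hβi.mono_set (by rw [uIcc_of_le hac, uIcc_of_le hat]; exact Icc_subset_Icc_right hct))
    rw [h2, hα, ← hφ]
  have hφβ : IntervalIntegrable (fun s => φ (X t) (β s)) volume a t :=
    (intervalIntegrable_iff_integrableOn_Ioc_of_le hat).2 ((φ (X t)).integrable_comp hβi.1)
  rw [hleft, hright, ← intervalIntegral.integral_of_le hat, ← intervalIntegral.integral_of_le hat,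
    intervalIntegral.integral_sub hφβ hb, (φ (X t)).intervalIntegral_comp_comm hβi] at hswap
  rw [← hswap]
  abel

end VariationOfConstants

/-! ### The Δ-measure as an image of Lebesgue measure, and `L¹` duality. -/

section DeltaMeasure

variable {T : Set ℝ}

theorem deltaMeasure_compl (hT : IsClosed T) : deltaMeasure T Tᶜ = 0 := by
  have hm : MeasurableSet Tᶜ := hT.measurableSet.compl
  rw [deltaMeasure, Measure.add_apply, Measure.restrict_apply hm, compl_inter_self, measure_empty,
    zero_add, Measure.sum_apply _ hm, ENNReal.tsum_eq_zero]
  rintro ⟨t, ht, -⟩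
  simp [Measure.dirac_apply' _ hm, ht]

theorem ae_mem_deltaMeasure (hT : IsClosed T) : ∀ᵐ t ∂(deltaMeasure T), t ∈ T :=
  mem_ae_iff.2 (deltaMeasure_compl hT)

variable {a b : ℝ}

/-- The Δ-measure on `[a, b)` is the image of Lebesgue measure under the retraction. -/
theorem map_lastPoint_volume (hT : IsClosed T) (h : IsRay (T ∩ Ici a) a)
    (hb : b ∈ T ∩ Ici a) :
    Measure.map (lastPoint (T ∩ Ici a) a) (volume.restrict (Ico a b)) =
      (deltaMeasure T).restrict (Ico a b) := by
  have hm : Measurable (lastPoint (T ∩ Ici a) a) := h.lastPoint_mono.measurable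
  -- Closed half-lines determine a finite measure. Up to Δ-null sets both measures see `[c, ∞)` as
  -- `[d, b)`, where `d` is the first point of the ray at or beyond `c`.
  refine Measure.ext_of_Ici _ _ fun c => ?_
  rw [Measure.map_apply hm measurableSet_Ici, Measure.restrict_apply (hm measurableSet_Ici),
    Measure.restrict_apply measurableSet_Ici]
  obtain ⟨s, hs, hcs⟩ := h.exists_gt c
  have hbd : BddBelow (T ∩ Ici a ∩ Ici c) := ⟨c, fun _ hx => hx.2⟩
  have hd := (h.closed.inter isClosed_Ici).csInf_mem ⟨s, hs, le_of_lt hcs⟩ hbd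
  set d := sInf (T ∩ Ici a ∩ Ici c) with hdef
  have hmin : ∀ x ∈ T ∩ Ici a, c ≤ x → d ≤ x := fun x hx hcx => csInf_le hbd ⟨hx, hcx⟩
  have h1 : lastPoint (T ∩ Ici a) a ⁻¹' Ici c ∩ Ico a b = Ico d b := by
    ext r
    constructor
    · rintro ⟨hr, har, hrb⟩
      exact ⟨(hmin _ (h.lastPoint_mem r) hr).trans (h.lastPoint_le har), hrb⟩
    · rintro ⟨hdr, hrb⟩
      exact ⟨hd.2.trans (h.le_lastPoint hd.1 hdr), (h.least.2 hd.1).trans hdr, hrb⟩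
  have h2 : deltaMeasure T (Ici c ∩ Ico a b) = deltaMeasure T (Ico d b) := by
    refine measure_congr ?_
    filter_upwards [ae_mem_deltaMeasure hT] with x hx
    refine propext ⟨?_, ?_⟩
    · rintro ⟨hcx, hax, hxb⟩
      exact ⟨hmin x ⟨hx, hax⟩ hcx, hxb⟩
    · rintro ⟨hdx, hxb⟩
      exact ⟨le_trans hd.2 hdx, (h.least.2 hd.1).trans hdx, hxb⟩
  rw [h1, h2, Real.volume_Ico]
  rcases le_total d b with hdb | hdb
  · rw [deltaMeasure_Ico hT hd.1.1 hb.1]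
  · rw [Ico_eq_empty (not_lt.2 hdb), measure_empty, ENNReal.ofReal_of_nonpos (sub_nonpos.2 hdb)]

variable {E : Type*} [NormedAddCommGroup E]

theorem integrableOn_deltaMeasure_iff (hT : IsClosed T) (h : IsRay (T ∩ Ici a) a)
    (hb : b ∈ T ∩ Ici a) {F : ℝ → E}
    (hF : AEStronglyMeasurable F ((deltaMeasure T).restrict (Ico a b))) :
    IntegrableOn F (Ico a b) (deltaMeasure T) ↔
      IntervalIntegrable (fun r => F (lastPoint (T ∩ Ici a) a r)) volume a b := by
  rw [intervalIntegrable_iff_integrableOn_Ico_of_le hb.2, IntegrableOn, IntegrableOn,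
    ← map_lastPoint_volume hT h hb] at *
  exact integrable_map_measure hF h.lastPoint_mono.measurable.aemeasurable

theorem setIntegral_deltaMeasure [NormedSpace ℝ E] (hT : IsClosed T) (h : IsRay (T ∩ Ici a) a)
    (hb : b ∈ T ∩ Ici a) {F : ℝ → E}
    (hF : AEStronglyMeasurable F ((deltaMeasure T).restrict (Ico a b))) :
    ∫ s in Ico a b, F s ∂(deltaMeasure T) =
      ∫ r in a..b, F (lastPoint (T ∩ Ici a) a r) := by
  rw [← map_lastPoint_volume hT h hb] at *
  rw [integral_map h.lastPoint_mono.measurable.aemeasurable hF,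
    intervalIntegral.integral_of_le hb.2, integral_Ico_eq_integral_Ioo,
    integral_Ioc_eq_integral_Ioo]

/-- The Δ-measure lives on `T`, where the retraction is the identity, so the measurable function `F
∘ lastPoint` is a version of `F`. -/
theorem RdContinuous.aestronglyMeasurable (hT : IsClosed T) (h : IsRay (T ∩ Ici a) a) {F : ℝ → E}
    (hF : RdContinuous (T ∩ Ici a) F) :
    AEStronglyMeasurable F ((deltaMeasure T).restrict (Ici a)) := by
  refine ⟨_, h.stronglyMeasurable_comp_lastPoint hF, ?_⟩
  filter_upwards [ae_restrict_mem measurableSet_Ici,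
    ae_restrict_of_ae (ae_mem_deltaMeasure hT)] with s hs hsT
  rw [h.lastPoint_self ⟨hsT, hs⟩]

theorem RdContinuous.integrableOn (hT : IsClosed T) (h : IsRay (T ∩ Ici a) a) {F : ℝ → E}
    (hF : RdContinuous (T ∩ Ici a) F) (hb : b ∈ T ∩ Ici a) :
    IntegrableOn F (Ico a b) (deltaMeasure T) :=
  (integrableOn_deltaMeasure_iff hT h hb ((hF.aestronglyMeasurable hT h).mono_measure
    (Measure.restrict_mono Ico_subset_Ici_self le_rfl))).2 (h.intervalIntegrable hF a b)

/-- `L¹` norms are computed by testing against continuous functions bounded by one. -/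
theorem integral_norm_le_of_continuous_test {μ : Measure ℝ} [IsFiniteMeasure μ] {g : ℝ → ℝ}
    (hg : Integrable g μ) {K : ℝ}
    (hK : ∀ f : ℝ → ℝ, Continuous f → (∀ s, |f s| ≤ 1) → |∫ s, f s * g s ∂μ| ≤ K) :
    ∫ s, ‖g s‖ ∂μ ≤ K := by
  refine le_of_forall_pos_le_add fun ε hε => ?_
  set V := μ.real univ with hV
  have hV0 : 0 ≤ V := measureReal_nonneg
  obtain ⟨k, hk, hki⟩ := hg.exists_boundedContinuous_integral_sub_le (ε := ε / 4) (by positivity)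
  set δ := ε / (4 * (V + 1)) with hδ
  have hδ0 : 0 < δ := by positivity
  have hδV : δ * V ≤ ε / 4 := by
    rw [hδ, div_mul_eq_mul_div, div_le_div_iff₀ (by positivity) (by norm_num)]
    nlinarith
  have hpos : ∀ s, 0 < |k s| + δ := fun s => by positivity
  -- A continuous substitute for the sign of `g`, built from a continuous `L¹` approximation `k`: it
  -- satisfies `|k| - δ ≤ f * k`. Replacing `k` by `g` costs `2 * ‖g - k‖`.
  set f : ℝ → ℝ := fun s => k s / (|k s| + δ) with hf
  have hfc : Continuous f := k.continuous.div (by fun_prop) fun s => (hpos s).ne'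
  have hf1 : ∀ s, |f s| ≤ 1 := by
    intro s
    rw [hf, abs_div, abs_of_pos (hpos s), div_le_one (hpos s)]
    linarith
  have hfg : Integrable (fun s => f s * g s) μ :=
    hg.bdd_mul (c := 1) hfc.aestronglyMeasurable (Eventually.of_forall hf1)
  have hd : Integrable (fun s => ‖g s - k s‖) μ := (hg.sub hki).norm
  have hfd : Integrable (fun s => f s * g s + 2 * ‖g s - k s‖) μ := hfg.add (hd.const_mul 2)
  have hpt : ∀ s, ‖g s‖ ≤ f s * g s + 2 * ‖g s - k s‖ + δ := by
    intro s
    have h1 : |k s| - δ ≤ f s * k s := by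
      rw [hf]
      simp only
      rw [div_mul_eq_mul_div, le_div_iff₀ (hpos s)]
      nlinarith [abs_mul_abs_self (k s)]
    have h2 : f s * k s - f s * g s ≤ ‖g s - k s‖ := by
      rw [← mul_sub]
      refine (le_abs_self _).trans ?_
      rw [abs_mul, abs_sub_comm]
      exact mul_le_of_le_one_left (abs_nonneg _) (hf1 s)
    have h3 : ‖g s‖ ≤ ‖g s - k s‖ + |k s| := by
      simpa using norm_add_le (g s - k s) (k s)
    linarith
  calc ∫ s, ‖g s‖ ∂μ ≤ ∫ s, (f s * g s + 2 * ‖g s - k s‖ + δ) ∂μ :=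
        integral_mono hg.norm (hfd.add (integrable_const δ)) hpt
    _ = (∫ s, f s * g s ∂μ) + 2 * (∫ s, ‖g s - k s‖ ∂μ) + δ * V := by
        rw [integral_add hfd (integrable_const δ),
          integral_add hfg (hd.const_mul 2), integral_const_mul, integral_const, smul_eq_mul,
          mul_comm δ]
    _ ≤ K + 2 * (ε / 4) + ε / 4 := by
        gcongr
        exact (le_abs_self _).trans (hK f hfc hf1)
    _ ≤ K + ε := by linarith

end DeltaMeasure

/-! ### The transition matrix, solutions, and the input-output formula. -/

section StateEquation

variable {n m p : ℕ}

/-- The action of matrices on Euclidean vectors as a continuous bilinear map. -/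
def euclideanAction (k l : ℕ) : Matrix (Fin k) (Fin l) ℝ →L[ℝ]
    EuclideanSpace ℝ (Fin l) →L[ℝ] EuclideanSpace ℝ (Fin k) :=
  LinearMap.toContinuousLinearMap
    (Matrix.toEuclideanLin.trans LinearMap.toContinuousLinearMap).toLinearMap

theorem euclideanAction_apply {k l : ℕ} (M : Matrix (Fin k) (Fin l) ℝ)
    (v : EuclideanSpace ℝ (Fin l)) : euclideanAction k l M v = M.toEuclideanLin v := rfl

theorem euclideanAction_mul {k l q : ℕ} (M : Matrix (Fin k) (Fin l) ℝ)
    (N : Matrix (Fin l) (Fin q) ℝ) (v : EuclideanSpace ℝ (Fin q)) :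
    euclideanAction k q (M * N) v = euclideanAction k l M (euclideanAction l q N v) := by
  simp [euclideanAction_apply, Matrix.toLpLin_apply, Matrix.mulVec_mulVec]

theorem euclideanAction_one (v : EuclideanSpace ℝ (Fin n)) : euclideanAction n n 1 v = v := by
  simp [euclideanAction_apply]

theorem norm_euclideanAction_le {k l : ℕ} (M : Matrix (Fin k) (Fin l) ℝ)
    (v : EuclideanSpace ℝ (Fin l)) : ‖euclideanAction k l M v‖ ≤ ‖M‖ * ‖v‖ :=
  Matrix.l2_opNorm_mulVec M v

theorem continuous_euclideanAction (k l : ℕ) :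
    Continuous (Function.uncurry fun (M : Matrix (Fin k) (Fin l) ℝ)
      (v : EuclideanSpace ℝ (Fin l)) => euclideanAction k l M v) := by
  unfold Function.uncurry
  fun_prop

variable {T : Set ℝ} {a : ℝ} {A : ℝ → Matrix (Fin n) (Fin n) ℝ}
  {B : ℝ → Matrix (Fin n) (Fin m) ℝ} {C : ℝ → Matrix (Fin p) (Fin n) ℝ}

theorem IsIntegralFundamental.isUnit {X : ℝ → Matrix (Fin n) (Fin n) ℝ} {S : Set ℝ}
    (hX : IsIntegralFundamental S a A X) (h : IsRay S a) (hA : RdContinuous S A)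
    (hreg : Regressive S A) {t : ℝ} (ht : t ∈ S) : IsUnit (X t) := by
  rw [Matrix.isUnit_iff_isUnit_det, isUnit_iff_ne_zero]
  intro hdet
  obtain ⟨v, hv, hXv⟩ := Matrix.exists_mulVec_eq_zero_iff.2 hdet
  -- The injectivity lemma lives in the matrix ring, so a kernel vector `v` is repeated as every
  -- column of a square matrix.
  have hN : X t * Matrix.vecMulVec v (fun _ : Fin n => (1 : ℝ)) = 0 := by
    rw [Matrix.mul_vecMulVec, hXv, Matrix.zero_vecMulVec]
  have h0 := hX.eq_zero_of_mul_eq_zero h hA hreg ht hN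
  refine hv (funext fun i => ?_)
  simpa [Matrix.vecMulVec_apply] using congrFun (congrFun h0 i) i

theorem Regressive.inter_Ici (hreg : Regressive T A) (r : ℝ) : Regressive (T ∩ Ici r) A := by
  intro t ht
  have := hreg t ht.1
  rwa [graininess, ← sigma_inter_Ici (S := T) (show r ≤ t from ht.2)] at this

/-- A continuous fundamental matrix on `S` together with its inverse. -/
theorem IsRay.exists_isIntegralFundamental_inverse {S : Set ℝ} (h : IsRay S a)
    (hA : RdContinuous S A) (hreg : Regressive S A) :
    ∃ X Y : ℝ → Matrix (Fin n) (Fin n) ℝ, IsIntegralFundamental S a A X ∧ ContinuousOn Y S ∧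
      ∀ t ∈ S, X t * Y t = 1 := by
  obtain ⟨X, hX⟩ := h.exists_isIntegralFundamental hA
  refine ⟨X, fun t => Ring.inverse (X t), hX, fun t ht => ?_, fun t ht =>
    Ring.mul_inverse_cancel _ (hX.isUnit h hA hreg ht)⟩
  obtain ⟨w, hw⟩ := hX.isUnit h hA hreg ht
  have h1 : ContinuousAt Ring.inverse (X t) := hw ▸ NormedRing.inverse_continuousAt w
  exact h1.comp_continuousWithinAt (hX.continuousOn t ht)

theorem IsIntegralFundamental.isFundamentalFrom {X : ℝ → Matrix (Fin n) (Fin n) ℝ}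
    (h : IsRay (T ∩ Ici a) a) (hA : RdContinuous (T ∩ Ici a) A)
    (hX : IsIntegralFundamental (T ∩ Ici a) a A X) : IsFundamentalFrom T A a X :=
  ⟨hX.apply_base h, fun _ ht hat =>
    h.hasDeltaDerivAt_of_integral (hX.rdContinuous_mul hA) hX.eq_integral ⟨ht, hat⟩⟩

theorem IsFundamentalFrom.isIntegralFundamental {X : ℝ → Matrix (Fin n) (Fin n) ℝ}
    (h : IsRay (T ∩ Ici a) a) (hA : RdContinuous (T ∩ Ici a) A)
    (hX : IsFundamentalFrom T A a X) : IsIntegralFundamental (T ∩ Ici a) a A X := by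
  have hc : ContinuousOn X (T ∩ Ici a) := fun t ht =>
    (hX.2 t ht.1 ht.2).continuousWithinAt ht
  refine ⟨hc, fun t ht => ?_⟩
  have h1 := h.eq_add_integral (hA.map₂ hc.rdContinuous continuous_mul)
    (fun t ht => hX.2 t ht.1 ht.2) ht
  rwa [hX.1] at h1

/-- `transitionMatrix` is an arbitrary choice of solution. Existence makes the choice a genuine
solution `Z` based at `r`, and the cocycle identity `Z t * X r = X t` pins down its value. -/
theorem transitionMatrix_eq (hT : IsClosed T) (hub : ¬ BddAbove T) (hA : RdContinuous T A)
    {X Y : ℝ → Matrix (Fin n) (Fin n) ℝ} (h : IsRay (T ∩ Ici a) a)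
    (hX : IsIntegralFundamental (T ∩ Ici a) a A X) (hXY : ∀ t ∈ T ∩ Ici a, X t * Y t = 1)
    {r t : ℝ} (hr : r ∈ T ∩ Ici a) (ht : t ∈ T) (hrt : r ≤ t) :
    transitionMatrix T A t r = X t * Y r := by
  have h' : IsRay (T ∩ Ici r) r := IsRay.of_inter_Ici hT hub hr.1
  have hex : ∃ Z, IsFundamentalFrom T A r Z := by
    obtain ⟨Z, hZ⟩ := h'.exists_isIntegralFundamental (hA.inter_Ici r)
    exact ⟨Z, hZ.isFundamentalFrom h' (hA.inter_Ici r)⟩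
  have hZ := (Classical.epsilon_spec hex).isIntegralFundamental h' (hA.inter_Ici r)
  have hset : T ∩ Ici a ∩ Ici r = T ∩ Ici r := by
    rw [inter_assoc, Ici_inter_Ici, sup_eq_right.2 (show a ≤ r from hr.2)]
  rw [← hset] at hZ
  rw [transitionMatrix, if_pos hrt,
    ← hX.mul_eq h (hA.inter_Ici a) hr hZ ⟨ht, le_trans hr.2 hrt⟩ hrt, mul_assoc, hXY r hr, mul_one]

/-- On `[a, t)` the weighting pattern agrees with an rd-continuous function. -/
theorem weightingPattern_eq (hT : IsClosed T) (hub : ¬ BddAbove T) (hA : RdContinuous T A)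
    {X Y : ℝ → Matrix (Fin n) (Fin n) ℝ} (h : IsRay (T ∩ Ici a) a)
    (hX : IsIntegralFundamental (T ∩ Ici a) a A X) (hXY : ∀ t ∈ T ∩ Ici a, X t * Y t = 1)
    {s t : ℝ} (hs : s ∈ T ∩ Ici a) (ht : t ∈ T) (hst : s < t) :
    weightingPattern T A B C t s = C t * X t * Y (sigma (T ∩ Ici a) s) * B s := by
  -- Since `s < t` gives `σ(s) ≤ t`, only the forward branch of `transitionMatrix` occurs.
  rw [weightingPattern, ← sigma_inter_Ici (S := T) (show a ≤ s from hs.2),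
    transitionMatrix_eq hT hub hA h hX hXY (h.sigma_mem s) ht
      (sigma_le ⟨ht, le_trans hs.2 hst.le⟩ hst), ← Matrix.mul_assoc (C t)]

theorem IsRay.rdContinuous_mul_comp_sigma_mul {S : Set ℝ} (h : IsRay S a)
    (hB : RdContinuous S B) {Y : ℝ → Matrix (Fin n) (Fin n) ℝ} (hY : ContinuousOn Y S)
    (M : Matrix (Fin p) (Fin n) ℝ) : RdContinuous S (fun s => M * Y (sigma S s) * B s) := by
  have hc : Continuous (Function.uncurry fun (N : Matrix (Fin n) (Fin n) ℝ)
      (K : Matrix (Fin n) (Fin m) ℝ) => M * N * K) := by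
    unfold Function.uncurry
    fun_prop
  exact (h.rdContinuous_comp_sigma hY).map₂ hB hc

theorem continuousOn_euclideanAction {S : Set ℝ} {Y : ℝ → Matrix (Fin n) (Fin n) ℝ}
    (hY : ContinuousOn Y S) {w : ℝ → EuclideanSpace ℝ (Fin n)} (hw : ContinuousOn w S) :
    ContinuousOn (fun t => euclideanAction n n (Y t) (w t)) S := fun t ht =>
  ((continuous_euclideanAction n n).continuousAt.comp_continuousWithinAt
    ((hY t ht).prodMk (hw t ht)) :)

theorem exists_rdContinuous_eq_weightingPattern (hT : IsClosed T) (hub : ¬ BddAbove T)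
    (hA : RdContinuous T A) (hB : RdContinuous T B) (hreg : Regressive T A)
    (ha : a ∈ T) {t : ℝ} (ht : t ∈ T) :
    ∃ g : ℝ → Matrix (Fin p) (Fin m) ℝ, RdContinuous (T ∩ Ici a) g ∧
      ∀ᵐ s ∂(deltaMeasure T).restrict (Ico a t), weightingPattern T A B C t s = g s := by
  have h : IsRay (T ∩ Ici a) a := IsRay.of_inter_Ici hT hub ha
  obtain ⟨X, Y, hX, hY, hXY⟩ :=
    h.exists_isIntegralFundamental_inverse (hA.inter_Ici a) (hreg.inter_Ici a)
  refine ⟨fun s => C t * X t * Y (sigma (T ∩ Ici a) s) * B s, ?_, ?_⟩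
  · exact h.rdContinuous_mul_comp_sigma_mul (hB.inter_Ici a) hY (C t * X t)
  · filter_upwards [ae_restrict_mem measurableSet_Ico,
      ae_restrict_of_ae (ae_mem_deltaMeasure hT)] with s hs hsT
    exact weightingPattern_eq hT hub hA h hX hXY ⟨hsT, hs.1⟩ ht hs.2

/-- The state `X(t) ∫_a^t X(σ(s))⁻¹ b(s) Δs` depends continuously on `t`. -/
theorem continuousOn_zeroState {S : Set ℝ} (h : IsRay S a)
    {X Y : ℝ → Matrix (Fin n) (Fin n) ℝ} (hX : ContinuousOn X S) (hY : ContinuousOn Y S)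
    {b : ℝ → EuclideanSpace ℝ (Fin n)} (hb : Integrable b) :
    ContinuousOn (fun t => euclideanAction n n (X t)
      (∫ s in a..t, euclideanAction n n (Y (sigma S (lastPoint S a s))) (b s))) S := by
  refine continuousOn_euclideanAction hX fun t ht => ?_
  have hint := h.intervalIntegrable_apply_sigma hY (euclideanAction n n)
    (hb.intervalIntegrable (a := a) (b := t + 1))
  have hat := h.least.2 ht
  have hc := intervalIntegral.continuousOn_primitive_interval (μ := volume) (a := a) (b := t + 1)
    (f := fun s => euclideanAction n n (Y (sigma S (lastPoint S a s))) (b s))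
    (by rwa [uIcc_of_le (by linarith), ← intervalIntegrable_iff_integrableOn_Icc_of_le
      (by linarith)])
  rw [uIcc_of_le (by linarith)] at hc
  refine (hc t ⟨hat, by linarith⟩).mono_of_mem_nhdsWithin ?_
  filter_upwards [self_mem_nhdsWithin, nhdsWithin_le_nhds (Iio_mem_nhds (lt_add_one t))]
    with s hs hs' using ⟨h.least.2 hs, le_of_lt hs'⟩

theorem rdContinuous_stateField {S : Set ℝ} (hA : RdContinuous S A) (hB : RdContinuous S B)
    {u : ℝ → EuclideanSpace ℝ (Fin m)} (hu : RdContinuous S u)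
    {x : ℝ → EuclideanSpace ℝ (Fin n)} (hx : ContinuousOn x S) :
    RdContinuous S (stateField A B u x) :=
  (hA.map₂ hx.rdContinuous (continuous_euclideanAction n n)).map₂
    (hB.map₂ hu (continuous_euclideanAction n m)) continuous_add

theorem IsSolution.isCaratheodorySolution (hT : IsClosed T) (h : IsRay (T ∩ Ici a) a)
    (hA : RdContinuous T A) (hB : RdContinuous T B) {u : ℝ → EuclideanSpace ℝ (Fin m)}
    (hu : RdContinuous (T ∩ Ici a) u) {x₀ : EuclideanSpace ℝ (Fin n)}
    {x : ℝ → EuclideanSpace ℝ (Fin n)} (hx : IsSolution T A B a x₀ u x) :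
    IsCaratheodorySolution T A B a x₀ u x := by
  have hF := rdContinuous_stateField (hA.inter_Ici a) (hB.inter_Ici a) hu
    (x := x) fun t ht => (hx.2 t ht.1 ht.2).continuousWithinAt ht
  intro t ht hat
  refine ⟨hF.integrableOn hT h ⟨ht, hat⟩, ?_⟩
  rw [setIntegral_deltaMeasure hT h ⟨ht, hat⟩ (hF.integrableOn hT h ⟨ht, hat⟩).1,
    h.eq_add_integral hF (fun t ht => hx.2 t ht.1 ht.2) ⟨ht, hat⟩, hx.1]

/-- Stability only constrains solutions that exist; this provides one for each test input in the
necessity proof. -/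
theorem exists_isSolution (hT : IsClosed T) (hub : ¬ BddAbove T) (hA : RdContinuous T A)
    (hB : RdContinuous T B) (hreg : Regressive T A) (ha : a ∈ T)
    {u : ℝ → EuclideanSpace ℝ (Fin m)} (hu : RdContinuous (T ∩ Ici a) u) :
    ∃ x, IsSolution T A B a 0 u x := by
  have h : IsRay (T ∩ Ici a) a := IsRay.of_inter_Ici hT hub ha
  obtain ⟨X, Y, hX, hY, hXY⟩ :=
    h.exists_isIntegralFundamental_inverse (hA.inter_Ici a) (hreg.inter_Ici a)
  have hBu := (hB.inter_Ici a).map₂ hu (continuous_euclideanAction n m)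
  have hβ := (h.rdContinuous_comp_sigma hY).map₂ hBu (continuous_euclideanAction n n)
  set S := T ∩ Ici a with hS
  set x : ℝ → EuclideanSpace ℝ (Fin n) := fun t => euclideanAction n n (X t)
    (∫ s in a..t, euclideanAction n n (Y (sigma S (lastPoint S a s)))
      (euclideanAction n m (B (lastPoint S a s)) (u (lastPoint S a s)))) with hx
  have hxc : ContinuousOn x S := continuousOn_euclideanAction hX.continuousOn
    (intervalIntegral.continuous_primitive
      (fun c d => h.intervalIntegrable hβ c d) a).continuousOn
  have hF := rdContinuous_stateField (hA.inter_Ici a) (hB.inter_Ici a) hu hxc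
  refine ⟨x, by simp [hx], fun t ht hat => h.hasDeltaDerivAt_of_integral hF (c := 0)
    (fun t ht => ?_) ⟨ht, hat⟩⟩
  have hAx := (hA.inter_Ici a).map₂ hxc.rdContinuous (continuous_euclideanAction n n)
  have h1 := hX.variation_of_constants h (hA.inter_Ici a) hY hXY (euclideanAction n n)
    euclideanAction_one euclideanAction_mul ht (h.intervalIntegrable hBu a t)
  rw [zero_add]
  refine h1.trans ?_
  rw [add_comm]
  exact (intervalIntegral.integral_add (h.intervalIntegrable hAx a t)
    (h.intervalIntegrable hBu a t)).symm

theorem RdContinuous.aestronglyMeasurable_euclideanAction (hT : IsClosed T)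
    (h : IsRay (T ∩ Ici a) a) {k l : ℕ} {g : ℝ → Matrix (Fin k) (Fin l) ℝ}
    (hg : RdContinuous (T ∩ Ici a) g) {w : ℝ → EuclideanSpace ℝ (Fin l)} {t : ℝ}
    (hw : AEStronglyMeasurable w ((deltaMeasure T).restrict (Ico a t))) :
    AEStronglyMeasurable (fun s => euclideanAction k l (g s) (w s))
      ((deltaMeasure T).restrict (Ico a t)) := by
  have h1 : AEStronglyMeasurable g ((deltaMeasure T).restrict (Ico a t)) :=
    (hg.aestronglyMeasurable hT h).mono_measure
      (Measure.restrict_mono Ico_subset_Ici_self le_rfl)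
  exact (euclideanAction k l).aestronglyMeasurable_comp₂ h1 hw

theorem RdContinuous.integrableOn_euclideanAction (hT : IsClosed T)
    (h : IsRay (T ∩ Ici a) a) {k l : ℕ} {g : ℝ → Matrix (Fin k) (Fin l) ℝ}
    (hg : RdContinuous (T ∩ Ici a) g) {w : ℝ → EuclideanSpace ℝ (Fin l)} {t : ℝ}
    (ht : t ∈ T ∩ Ici a) (hw : AEStronglyMeasurable w ((deltaMeasure T).restrict (Ico a t)))
    {K : ℝ} (hK : ∀ s ∈ T ∩ Ici a, s ≤ t → ‖w s‖ ≤ K) :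
    IntegrableOn (fun s => euclideanAction k l (g s) (w s)) (Ico a t) (deltaMeasure T) := by
  obtain ⟨M, hM0, hM⟩ := hg.exists_bound h t
  have hfin : deltaMeasure T (Ico a t) < ⊤ := by
    rw [deltaMeasure_Ico hT h.least.1.1 ht.1]
    exact ENNReal.ofReal_lt_top
  have hb : ∀ᵐ s ∂(deltaMeasure T).restrict (Ico a t),
      ‖euclideanAction k l (g s) (w s)‖ ≤ M * K := by
    filter_upwards [ae_restrict_mem measurableSet_Ico,
      ae_restrict_of_ae (ae_mem_deltaMeasure hT)] with s hs hsT
    have h1 := hM s ⟨hsT, hs.1⟩ hs.2.le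
    have h2 := hK s ⟨hsT, hs.1⟩ hs.2.le
    exact (norm_euclideanAction_le _ _).trans (mul_le_mul h1 h2 (norm_nonneg _) hM0)
  exact IntegrableOn.of_bound hfin (hg.aestronglyMeasurable_euclideanAction hT h hw) (M * K) hb

/-- The zero-state response is the integral of the weighting pattern against the input. -/
theorem IsCaratheodorySolution.output_eq (hT : IsClosed T) (hub : ¬ BddAbove T)
    (hA : RdContinuous T A) (hB : RdContinuous T B) (hreg : Regressive T A) (ha : a ∈ T)
    {u : ℝ → EuclideanSpace ℝ (Fin m)} {x : ℝ → EuclideanSpace ℝ (Fin n)}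
    (hu : AEStronglyMeasurable u ((deltaMeasure T).restrict (Ici a)))
    {t : ℝ} (ht : t ∈ T ∩ Ici a) {K : ℝ} (hK : ∀ s ∈ T ∩ Ici a, s ≤ t → ‖u s‖ ≤ K)
    (hx : IsCaratheodorySolution T A B a 0 u x) :
    euclideanAction p n (C t) (x t) =
      ∫ s in Ico a t, euclideanAction p m (weightingPattern T A B C t s) (u s)
        ∂(deltaMeasure T) := by
  have h : IsRay (T ∩ Ici a) a := IsRay.of_inter_Ici hT hub ha
  have hA' := hA.inter_Ici a
  have hB' := hB.inter_Ici a
  obtain ⟨X, Y, hX, hY, hXY⟩ :=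
    h.exists_isIntegralFundamental_inverse hA' (hreg.inter_Ici a)
  have hat : a ≤ t := ht.2
  have huI : AEStronglyMeasurable u ((deltaMeasure T).restrict (Ico a t)) :=
    hu.mono_measure (Measure.restrict_mono Ico_subset_Ici_self le_rfl)
  set S := T ∩ Ici a with hS
  set bu : ℝ → EuclideanSpace ℝ (Fin n) := fun s => euclideanAction n m (B s) (u s) with hbu
  have hbuI : IntervalIntegrable (fun r => bu (lastPoint S a r)) volume a t :=
    (integrableOn_deltaMeasure_iff hT h ht
      (hB'.aestronglyMeasurable_euclideanAction hT h huI)).1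
      (hB'.integrableOn_euclideanAction hT h ht huI hK)
  -- The forcing is known to be integrable only up to `t`; cutting it off there makes `z` continuous
  -- on all of `S`.
  set b : ℝ → EuclideanSpace ℝ (Fin n) := (Ioc a t).indicator fun r => bu (lastPoint S a r) with hb
  have hbi : Integrable b := (integrable_indicator_iff measurableSet_Ioc).2
    ((intervalIntegrable_iff_integrableOn_Ioc_of_le hat).1 hbuI)
  have hbeq : ∀ r ∈ Ioc a t, b r = bu (lastPoint S a r) := fun r hr => indicator_of_mem hr _
  set z : ℝ → EuclideanSpace ℝ (Fin n) := fun t => euclideanAction n n (X t)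
    (∫ s in a..t, euclideanAction n n (Y (sigma S (lastPoint S a s))) (b s)) with hz
  have hzc : ContinuousOn z S := continuousOn_zeroState h hX.continuousOn hY hbi
  have hAz := hA'.map₂ hzc.rdContinuous (continuous_euclideanAction n n)
  have hzeq : ∀ s ∈ S, z s = (∫ r in a..s, b r) +
      ∫ q in a..s, euclideanAction n n (A (lastPoint S a q)) (z (lastPoint S a q)) :=
    fun s hs => hX.variation_of_constants h hA' hY hXY (euclideanAction n n)
      euclideanAction_one euclideanAction_mul hs hbi.intervalIntegrable
  have hxI : ∀ s ∈ S, IntervalIntegrable (fun r => stateField A B u x (lastPoint S a r))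
      volume a s := fun s hs => (integrableOn_deltaMeasure_iff hT h hs (hx s hs.1 hs.2).1.1).1
        (hx s hs.1 hs.2).1
  have hxeq : ∀ s ∈ S, x s = ∫ r in a..s, stateField A B u x (lastPoint S a r) := by
    intro s hs
    rw [← setIntegral_deltaMeasure hT h hs (hx s hs.1 hs.2).1.1, (hx s hs.1 hs.2).2, zero_add]
  have hAzI := fun c d => h.intervalIntegrable hAz c d
  obtain ⟨M, hM0, hM⟩ := hA'.exists_bound h t
  -- Up to `t`, both `x` and the explicit `z` solve the same integral equation, so Grönwall applies
  -- to their difference.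
  have hxz : x t - z t = 0 := by
    refine h.eq_zero_of_eq_integral (x := fun s => x s - z s) (b := t) hM0
      (v := fun r => (Ioc a t).indicator (fun r => euclideanAction n n (A (lastPoint S a r))
        (x (lastPoint S a r) - z (lastPoint S a r))) r) ?_ ?_ ?_ ht le_rfl
    · refine (((hxI t ht).sub hbi.intervalIntegrable).sub (hAzI a t)).congr ?_
      intro r hr
      rw [uIoc_of_le hat] at hr
      simp only [indicator_of_mem hr, hbeq r hr, map_sub, hbu, stateField, euclideanAction_apply]
      abel
    · intro s hs hst
      rw [hzeq s hs, hxeq s hs, ← sub_sub,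
        ← intervalIntegral.integral_sub (hxI s hs) hbi.intervalIntegrable,
        ← intervalIntegral.integral_sub ((hxI s hs).sub hbi.intervalIntegrable) (hAzI a s)]
      refine intervalIntegral.integral_congr_ae (Eventually.of_forall fun r hr => ?_)
      rw [uIoc_of_le (h.least.2 hs)] at hr
      have hr' : r ∈ Ioc a t := ⟨hr.1, hr.2.trans hst⟩
      simp only [indicator_of_mem hr', hbeq r hr', map_sub, hbu, stateField, euclideanAction_apply]
      abel
    · intro r hr
      refine (norm_indicator_le_norm_self _ _).trans ((norm_euclideanAction_le _ _).trans ?_)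
      exact mul_le_mul_of_nonneg_right
        (hM _ (h.lastPoint_mem r) ((h.lastPoint_le hr.1).trans hr.2)) (norm_nonneg _)
  set g : ℝ → Matrix (Fin p) (Fin m) ℝ := fun s => C t * X t * Y (sigma S s) * B s with hg
  have hgrd : RdContinuous S g := h.rdContinuous_mul_comp_sigma_mul hB' hY (C t * X t)
  have hright : ∫ s in Ico a t, euclideanAction p m (weightingPattern T A B C t s) (u s)
        ∂(deltaMeasure T) = ∫ s in Ico a t, euclideanAction p m (g s) (u s) ∂(deltaMeasure T) := by
    refine integral_congr_ae ?_
    filter_upwards [ae_restrict_mem measurableSet_Ico,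
      ae_restrict_of_ae (ae_mem_deltaMeasure hT)] with s hs hsT
    rw [weightingPattern_eq hT hub hA h hX hXY ⟨hsT, hs.1⟩ ht.1 hs.2]
  rw [hright, setIntegral_deltaMeasure hT h ht (hgrd.aestronglyMeasurable_euclideanAction hT h huI), sub_eq_zero.1 hxz, hz]
  have hYb := h.intervalIntegrable_apply_sigma hY (euclideanAction n n)
    (hbi.intervalIntegrable (a := a) (b := t))
  simp only [← euclideanAction_mul]
  rw [← (euclideanAction p n (C t * X t)).intervalIntegral_comp_comm hYb]
  refine intervalIntegral.integral_congr_ae (Eventually.of_forall fun r hr => ?_)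
  rw [uIoc_of_le hat] at hr
  rw [hbeq r hr, hbu, hg]
  simp only [euclideanAction_mul]
  rfl

end StateEquation

/-! ### From the input-output formula to the two implications. -/

section Stability

variable {n m p : ℕ} {T : Set ℝ} {A : ℝ → Matrix (Fin n) (Fin n) ℝ}
  {B : ℝ → Matrix (Fin n) (Fin m) ℝ} {C : ℝ → Matrix (Fin p) (Fin n) ℝ}

theorem le_supNormFrom {E : Type*} [NormedAddCommGroup E] {a t : ℝ} (ht : t ∈ T ∩ Ici a)
    (f : ℝ → E) : ‖f t‖ₑ ≤ supNormFrom T a f :=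
  le_iSup₂ (f := fun (t : ℝ) (_ : t ∈ T ∩ Ici a) => ‖f t‖ₑ) t ht

/-- The bound on the zero-state response that follows from a bounded weighting pattern. -/
theorem IsCaratheodorySolution.supNormFrom_output_le (hT : IsClosed T) (hub : ¬ BddAbove T)
    (hA : RdContinuous T A) (hB : RdContinuous T B) (hreg : Regressive T A) {ρ : ℝ≥0}
    (hρ : ∀ τ ∈ T, ∀ t ∈ T, τ ≤ t →
      ∫⁻ s in Ico τ t, ‖weightingPattern T A B C t s‖ₑ ∂(deltaMeasure T) ≤ ρ)
    {a : ℝ} (ha : a ∈ T) {u : ℝ → EuclideanSpace ℝ (Fin m)}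
    {x : ℝ → EuclideanSpace ℝ (Fin n)}
    (hu : AEStronglyMeasurable u ((deltaMeasure T).restrict (Ici a)))
    (hx : IsCaratheodorySolution T A B a 0 u x) :
    supNormFrom T a (fun t => (C t).toEuclideanLin (x t)) ≤
      ((ρ + 1 : ℝ≥0) : ℝ≥0∞) * supNormFrom T a u := by
  -- An unbounded input has a trivial bound because `ρ + 1 ≠ 0`; with `ρ = 0` the convention `0 * ∞
  -- = 0` would demand a zero output.
  rcases eq_or_ne (supNormFrom T a u) ⊤ with htop | htop
  · rw [htop, ENNReal.mul_top (by simp)]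
    exact le_top
  refine iSup₂_le fun t ht => ?_
  have hK : ∀ s ∈ T ∩ Ici a, s ≤ t → ‖u s‖ ≤ (supNormFrom T a u).toReal := fun s hs _ => by
    rw [← toReal_enorm]
    exact ENNReal.toReal_mono htop (le_supNormFrom hs u)
  have hy := hx.output_eq (C := C) hT hub hA hB hreg ha hu ht hK
  change ‖euclideanAction p n (C t) (x t)‖ₑ ≤ _
  rw [hy]
  calc ‖∫ s in Ico a t, euclideanAction p m (weightingPattern T A B C t s) (u s)
        ∂(deltaMeasure T)‖ₑ
      ≤ ∫⁻ s in Ico a t, ‖euclideanAction p m (weightingPattern T A B C t s) (u s)‖ₑ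
        ∂(deltaMeasure T) := enorm_integral_le_lintegral_enorm _
    _ ≤ ∫⁻ s in Ico a t, ‖weightingPattern T A B C t s‖ₑ * supNormFrom T a u
        ∂(deltaMeasure T) := by
        refine lintegral_mono_ae ?_
        filter_upwards [ae_restrict_mem measurableSet_Ico,
          ae_restrict_of_ae (ae_mem_deltaMeasure hT)] with s hs hsT
        have h1 : ‖euclideanAction p m (weightingPattern T A B C t s) (u s)‖ₑ ≤
            ‖weightingPattern T A B C t s‖ₑ * ‖u s‖ₑ := by
          have h2 := ENNReal.ofReal_le_ofReal
            (norm_euclideanAction_le (weightingPattern T A B C t s) (u s))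
          rwa [ENNReal.ofReal_mul (norm_nonneg _), ofReal_norm, ofReal_norm, ofReal_norm] at h2
        exact h1.trans (by gcongr; exact le_supNormFrom ⟨hsT, hs.1⟩ u)
    _ = (∫⁻ s in Ico a t, ‖weightingPattern T A B C t s‖ₑ ∂(deltaMeasure T)) *
        supNormFrom T a u := lintegral_mul_const' _ _ htop
    _ ≤ ((ρ + 1 : ℝ≥0) : ℝ≥0∞) * supNormFrom T a u := by
        gcongr
        exact (hρ a ha t ht.1 ht.2).trans (by simp)

theorem norm_le_sum_norm_single_mul (M : Matrix (Fin p) (Fin m) ℝ) :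
    ‖M‖ ≤ ∑ i, ∑ j, ‖Matrix.single i j (1 : ℝ)‖ * |M i j| := by
  conv_lhs => rw [Matrix.matrix_eq_sum_single M]
  refine (norm_sum_le _ _).trans (Finset.sum_le_sum fun i _ => ?_)
  refine (norm_sum_le _ _).trans (Finset.sum_le_sum fun j _ => ?_)
  have : Matrix.single i j (M i j) = M i j • Matrix.single i j (1 : ℝ) := by
    rw [Matrix.smul_single, smul_eq_mul, mul_one]
  rw [this, norm_smul, mul_comm, Real.norm_eq_abs]

theorem euclideanAction_smul_single (M : Matrix (Fin p) (Fin m) ℝ) (c : ℝ) (i : Fin p)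
    (j : Fin m) : euclideanAction p m M (c • EuclideanSpace.single j 1) i = c * M i j := by
  rw [map_smul, PiLp.smul_apply, smul_eq_mul, euclideanAction_apply, Matrix.toLpLin_apply]
  simp

/-- If the responses to all continuous inputs bounded by one are bounded by `η`, then the
weighting pattern is bounded. -/
theorem weightingPatternBounded_of_continuous_test (hT : IsClosed T) (hub : ¬ BddAbove T)
    (hA : RdContinuous T A) (hB : RdContinuous T B) (hreg : Regressive T A) {η : ℝ≥0}
    (hη : ∀ τ ∈ T, ∀ t ∈ T, τ ≤ t → ∀ u : ℝ → EuclideanSpace ℝ (Fin m), Continuous u →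
      (∀ s, ‖u s‖ ≤ 1) →
      ‖∫ s in Ico τ t, euclideanAction p m (weightingPattern T A B C t s) (u s)
        ∂(deltaMeasure T)‖ ≤ η) :
    WeightingPatternBounded T A B C := by
  refine ⟨∑ i : Fin p, ∑ j : Fin m, ‖Matrix.single i j (1 : ℝ)‖₊ * η, fun τ hτ t ht hτt => ?_⟩
  have h : IsRay (T ∩ Ici τ) τ := IsRay.of_inter_Ici hT hub hτ
  obtain ⟨g, hg, hGg⟩ := exists_rdContinuous_eq_weightingPattern (C := C) hT hub hA hB hreg hτ ht
  set μ := (deltaMeasure T).restrict (Ico τ t) with hμ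
  have hfin : IsFiniteMeasure μ := ⟨by
    rw [hμ, Measure.restrict_apply_univ, deltaMeasure_Ico hT hτ ht]
    exact ENNReal.ofReal_lt_top⟩
  have hgi : Integrable g μ := hg.integrableOn hT h ⟨ht, hτt⟩
  have hgij : ∀ i j, Integrable (fun s => g s i j) μ := fun i j =>
    (LinearMap.toContinuousLinearMap (Matrix.entryLinearMap ℝ ℝ i j)).integrable_comp hgi
  -- The input `f e_j` isolates the entry `(i, j)`, and a coordinate is at most the Euclidean norm.
  have hentry : ∀ i j, ∫ s, ‖g s i j‖ ∂μ ≤ η := by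
    intro i j
    refine integral_norm_le_of_continuous_test (hgij i j) fun f hf hf1 => ?_
    have hu : Continuous fun s => f s • (EuclideanSpace.single j 1 : EuclideanSpace ℝ (Fin m)) :=
      hf.smul continuous_const
    have hu1 : ∀ s, ‖f s • (EuclideanSpace.single j 1 : EuclideanSpace ℝ (Fin m))‖ ≤ 1 := by
      intro s
      rw [norm_smul, PiLp.norm_single, norm_one, mul_one]
      exact hf1 s
    have hI : Integrable (fun s => euclideanAction p m (g s)
        (f s • (EuclideanSpace.single j 1 : EuclideanSpace ℝ (Fin m)))) μ :=
      hg.integrableOn_euclideanAction hT h ⟨ht, hτt⟩ hu.aestronglyMeasurable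
        (K := 1) fun s _ _ => hu1 s
    have h1 := hη τ hτ t ht hτt _ hu hu1
    rw [integral_congr_ae (hGg.mono fun s hs => by rw [hs])] at h1
    have h2 : ∫ s, f s * g s i j ∂μ = (∫ s, euclideanAction p m (g s)
        (f s • (EuclideanSpace.single j 1 : EuclideanSpace ℝ (Fin m))) ∂μ) i :=
      (integral_congr_ae (Eventually.of_forall fun s =>
        (euclideanAction_smul_single (g s) (f s) i j).symm)).trans
        ((EuclideanSpace.proj i : EuclideanSpace ℝ (Fin p) →L[ℝ] ℝ).integral_comp_comm hI)
    rw [h2, ← Real.norm_eq_abs]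
    exact (PiLp.norm_apply_le _ i).trans h1
  have hsum : ∫ s, ‖g s‖ ∂μ ≤ ∑ i : Fin p, ∑ j : Fin m, ‖Matrix.single i j (1 : ℝ)‖ * (η : ℝ) := by
    have hint : ∀ i j, Integrable (fun s => ‖Matrix.single i j (1 : ℝ)‖ * |g s i j|) μ :=
      fun i j => (hgij i j).norm.const_mul _
    calc ∫ s, ‖g s‖ ∂μ ≤ ∫ s, ∑ i, ∑ j, ‖Matrix.single i j (1 : ℝ)‖ * |g s i j| ∂μ :=
          integral_mono hgi.norm
            (integrable_finsetSum _ fun i _ => integrable_finsetSum _ fun j _ => hint i j)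
            fun s => norm_le_sum_norm_single_mul (g s)
      _ = ∑ i, ∑ j, ‖Matrix.single i j (1 : ℝ)‖ * ∫ s, |g s i j| ∂μ := by
          rw [integral_finsetSum _ fun i _ => integrable_finsetSum _ fun j _ => hint i j]
          refine Finset.sum_congr rfl fun i _ => ?_
          rw [integral_finsetSum _ fun j _ => hint i j]
          exact Finset.sum_congr rfl fun j _ => integral_const_mul _ _
      _ ≤ _ := by
          gcongr with i _ j _
          exact hentry i j
  have hG : ∫⁻ s, ‖weightingPattern T A B C t s‖ₑ ∂μ = ENNReal.ofReal (∫ s, ‖g s‖ ∂μ) := by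
    rw [ofReal_integral_norm_eq_lintegral_enorm hgi]
    exact lintegral_congr_ae (hGg.mono fun s hs => congrArg enorm hs)
  rw [hG]
  refine ENNReal.ofReal_le_of_le_toReal (hsum.trans_eq ?_)
  rw [ENNReal.coe_toReal]
  simp

theorem norm_response_le_of_supNormFrom_le {τ t : ℝ} (ht : t ∈ T ∩ Ici τ) {η : ℝ≥0}
    {u : ℝ → EuclideanSpace ℝ (Fin m)} (hu1 : ∀ s, ‖u s‖ ≤ 1)
    {x : ℝ → EuclideanSpace ℝ (Fin n)}
    (hx : supNormFrom T τ (fun t => (C t).toEuclideanLin (x t)) ≤ η * supNormFrom T τ u) :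
    ‖euclideanAction p n (C t) (x t)‖ ≤ η := by
  have h1 : supNormFrom T τ u ≤ 1 := iSup₂_le fun s _ => by
    rw [← ofReal_norm]
    exact ENNReal.ofReal_le_one.2 (hu1 s)
  have h2 : ‖euclideanAction p n (C t) (x t)‖ₑ ≤ η :=
    ((le_supNormFrom ht fun t => (C t).toEuclideanLin (x t)).trans hx).trans
      (mul_le_of_le_one_right' h1)
  rw [← toReal_enorm]
  exact ENNReal.toReal_le_coe_of_le_coe h2

end Stability

end TimeScale

end

/-! ### The two equivalences. -/

theorem theorem5p6 {n m p : ℕ} (T : Set ℝ) (hT_nonempty : T.Nonempty) (hT_closed : IsClosed T)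
    (hT_unbounded : ¬ BddAbove T) (hT_grain : ∃ M : ℝ, ∀ t ∈ T, TimeScale.graininess T t ≤ M)
    (A : ℝ → Matrix (Fin n) (Fin n) ℝ) (B : ℝ → Matrix (Fin n) (Fin m) ℝ)
    (C : ℝ → Matrix (Fin p) (Fin n) ℝ) (hA : TimeScale.RdContinuous T A)
    (hB : TimeScale.RdContinuous T B) (hC : TimeScale.RdContinuous T C)
    (hreg : TimeScale.Regressive T A) :
    (TimeScale.UniformlyBIBOStable T A B C ↔ TimeScale.WeightingPatternBounded T A B C) ∧
    (TimeScale.UniformlyBIBOStableMeasurable T A B C ↔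
      TimeScale.WeightingPatternBounded T A B C) := by
  refine ⟨⟨?_, ?_⟩, ⟨?_, ?_⟩⟩
  · rintro ⟨η, hη⟩
    refine TimeScale.weightingPatternBounded_of_continuous_test hT_closed hT_unbounded hA hB hreg
      (η := η) fun τ hτ t ht hτt u hu hu1 => ?_
    have h := TimeScale.IsRay.of_inter_Ici hT_closed hT_unbounded hτ
    have hur : TimeScale.RdContinuous (T ∩ Ici τ) u := hu.continuousOn.rdContinuous
    obtain ⟨x, hx⟩ := TimeScale.exists_isSolution hT_closed hT_unbounded hA hB hreg hτ hur
    rw [← (hx.isCaratheodorySolution hT_closed h hA hB hur).output_eq (C := C) hT_closed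
      hT_unbounded hA hB hreg hτ hu.aestronglyMeasurable ⟨ht, hτt⟩ fun s _ _ => hu1 s]
    exact TimeScale.norm_response_le_of_supNormFrom_le ⟨ht, hτt⟩ hu1 (hη τ hτ u hur x hx)
  · rintro ⟨ρ, hρ⟩
    refine ⟨ρ + 1, fun a ha u hu x hx => ?_⟩
    have h := TimeScale.IsRay.of_inter_Ici hT_closed hT_unbounded ha
    exact (hx.isCaratheodorySolution hT_closed h hA hB hu).supNormFrom_output_le hT_closed
      hT_unbounded hA hB hreg hρ ha (hu.aestronglyMeasurable hT_closed h)
  · rintro ⟨η, hη⟩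
    refine TimeScale.weightingPatternBounded_of_continuous_test hT_closed hT_unbounded hA hB hreg
      (η := η) fun τ hτ t ht hτt u hu hu1 => ?_
    have h := TimeScale.IsRay.of_inter_Ici hT_closed hT_unbounded hτ
    have hur : TimeScale.RdContinuous (T ∩ Ici τ) u := hu.continuousOn.rdContinuous
    -- Continuous test inputs suffice here too: their classical solutions are Carathéodory
    -- solutions.
    obtain ⟨x, hx⟩ := TimeScale.exists_isSolution hT_closed hT_unbounded hA hB hreg hτ hur
    have hx' := hx.isCaratheodorySolution hT_closed h hA hB hur
    rw [← hx'.output_eq (C := C) hT_closed hT_unbounded hA hB hreg hτ hu.aestronglyMeasurable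
      ⟨ht, hτt⟩ fun s _ _ => hu1 s]
    exact TimeScale.norm_response_le_of_supNormFrom_le ⟨ht, hτt⟩ hu1
      (hη τ hτ u hu.aestronglyMeasurable x hx')
  · rintro ⟨ρ, hρ⟩
    exact ⟨ρ + 1, fun a ha u hu x hx => hx.supNormFrom_output_le hT_closed hT_unbounded hA hB
      hreg hρ ha hu⟩
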